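/- Let $c_1,c_2>0$ and $g,h,q\in\mathbb R$ with $q\neq 0$. Consider on $x\in(0,1)$, $t\ge 0$ the closed loop of a string $u$ and a wave-equation controller $v$, $$u_{tt}=c_1^2u_{xx},\qquad u_x(0,t)=g\,u_t(0,t),\qquad u(1,t)=v(0,t),$$ $$v_{tt}=c_2^2v_{xx},\qquad v_x(0,t)=u_x(1,t),\qquad v_x(1,t)=-h\,v_t(1,t)-q\,v(1,t),$$ with initial state $(u^0,u^0_t,v^0,v^0_t)$ in $$\mathcal H=\{(u,p,v,r)\in H^1(0,1)\times L^2(0,1)\times H^1(0,1)\times L^2(0,1):\ u(1)=v(0)\},$$ and put $$\|(u,p,v,r)\|_{\mathcal H_0}^2=c_1^2\|u_x\|^2+\|p\|^2+c_2^2\|v_x\|^2+\|r\|^2+v(1)^2,$$ where $\|\cdot\|$ is the norm of $L^2(0,1)$. Let $A(u,p,v,r)=(p,\,c_1^2u_{xx},\,r,\,c_2^2v_{xx})$ be the operator in $\mathcal H$ whose domain consists of the $(u,p,v,r)\in\mathcal H$ with $u,v\in H^2(0,1)$, $p,r\in H^1(0,1)$, $p(1)=r(0)$, $u_x(0)=g\,p(0)$,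 $v_x(0)=u_x(1)$ and $v_x(1)=-h\,r(1)-q\,v(1)$. A solution with initial state $z_0\in\mathcal H$ is a continuous function $z:[0,\infty)\to\mathcal H$ such that, for all $t\ge 0$, $\int_0^t z(s)\,ds$ lies in the domain of $A$ and $z(t)=z_0+A\int_0^t z(s)\,ds$ (a mild solution). For real numbers $S_1,\dots,S_5$ and $\alpha$ let $S=\mathrm{diag}(S_1,S_2,S_3,S_4)$, $E_\alpha=\mathrm{diag}(e^{2\alpha/c_1},e^{2\alpha/c_1},e^{2\alpha/c_2},e^{2\alpha/c_2})$, $$H=\begin{bmatrix}0&c_1&1&0&0\\1-c_1g&0&0&0&0\\0&0&0&1-c_2h&-c_2q\\0&-c_2&1&0&0\end{bmatrix},\qquad G=\begin{bmatrix}1+c_1g&0&0&0&0\\0&-c_1&1&0&0\\0&c_2&1&0&0\\0&0&0&1+c_2h&c_2q\end{bmatrix},$$ let $Q_\alpha$ be the $5\times5$ matrix whose only possibly nonzero entries are $(Q_\alpha)_{45}=(Q_\alpha)_{54}=S_5$ and $(Q_\alpha)_{55}=2\alpha S_5$, and let $$\Psi_{c_1,c_1g}(\alpha)=H^\top E_\alpha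 S H-G^\top S G+Q_\alpha .$$ Theorem. Suppose that there are $S_1,\dots,S_5>0$ for which the symmetric matrix $\Psi_{c_1,c_1g}(0)$ is negative definite. Then there are constants $\gamma>1$ and $\alpha>0$, independent of the initial state, such that for every $z_0\in\mathcal H$ the closed loop has a unique solution $z$ on $[0,\infty)$ with initial state $z_0$; it satisfies $$\|z(t)\|_{\mathcal H_0}\le\gamma\,\|z_0\|_{\mathcal H_0}\,e^{-\alpha t}\qquad(t\ge 0),$$ and $z(t)\to 0$ in $\mathcal H$ as $t\to\infty$. -/

import Mathlib

open MeasureTheory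

namespace WaveLoop

noncomputable section

/-- The Hilbert space `L²([0,1]; ℝ)`. -/
abbrev L2 : Type := Lp ℝ 2 (volume.restrict (Set.Icc (0 : ℝ) 1))

theorem L2.intervalIntegrable (w : L2) (x : unitInterval) :
    IntervalIntegrable (fun y => w y) volume (0 : ℝ) x := by
  rw [intervalIntegrable_iff_integrableOn_Ioc_of_le x.2.1]
  have h : IntegrableOn (fun y => w y) (Set.Icc (0 : ℝ) 1) volume :=
    (Lp.memLp w).integrable (by norm_num)
  exact h.mono_set (fun y hy => ⟨hy.1.le, hy.2.trans x.2.2⟩)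

theorem L2.ae_Ioc {P : ℝ → Prop} (h : ∀ᵐ y ∂(volume.restrict (Set.Icc (0 : ℝ) 1)), P y)
    (x : unitInterval) : ∀ᵐ y ∂volume, y ∈ Set.Ioc (0 : ℝ) x → P y := by
  rw [ae_restrict_iff' measurableSet_Icc] at h
  filter_upwards [h] with y hy hyx
  exact hy ⟨hyx.1.le, hyx.2.trans x.2.2⟩

theorem L2.integral_add (w₁ w₂ : L2) (x : unitInterval) :
    ∫ y in (0 : ℝ)..x, (w₁ + w₂ : L2) y
      = (∫ y in (0 : ℝ)..x, w₁ y) + ∫ y in (0 : ℝ)..x, w₂ y := by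
  rw [← intervalIntegral.integral_add (w₁.intervalIntegrable x) (w₂.intervalIntegrable x)]
  apply intervalIntegral.integral_congr_ae
  rw [Set.uIoc_of_le x.2.1]
  exact L2.ae_Ioc (Lp.coeFn_add w₁ w₂) x

theorem L2.integral_smul (a : ℝ) (w : L2) (x : unitInterval) :
    ∫ y in (0 : ℝ)..x, (a • w : L2) y = a * ∫ y in (0 : ℝ)..x, w y := by
  rw [← intervalIntegral.integral_const_mul]
  apply intervalIntegral.integral_congr_ae
  rw [Set.uIoc_of_le x.2.1]
  exact L2.ae_Ioc (Lp.coeFn_smul a w) x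

/-- The Sobolev space `H¹([0,1]; ℝ)`, as a subspace of `C([0,1]) × L²`. An element is a pair `(f, f')` of the continuous
representative `f` and its derivative `f' ∈ L²`, related by `f(x) = f(0) + ∫₀ˣ f'(y) dy`; the
component `f'` is determined by `f`. The topology inherited from `C([0,1]) × L²` is
the usual one of `H¹`. -/
def H1Sub : Submodule ℝ (C(unitInterval, ℝ) × L2) where
  carrier := {f | ∀ x : unitInterval, f.1 x = f.1 0 + ∫ y in (0 : ℝ)..x, f.2 y}
  add_mem' := by
    intro f k hf hk x
    simp only [Prod.fst_add, Prod.snd_add, ContinuousMap.add_apply, L2.integral_add]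
    rw [hf x, hk x]
    ring
  zero_mem' := by
    intro x
    have h := L2.integral_smul 0 0 x
    rw [zero_smul, zero_mul] at h
    simpa using h.symm
  smul_mem' := by
    intro a f hf x
    simp only [Prod.smul_fst, Prod.smul_snd, ContinuousMap.smul_apply, L2.integral_smul,
      smul_eq_mul]
    rw [hf x]
    ring

/-- `H¹` is closed in `C([0,1]) × L²`. -/
theorem H1Sub_isClosed : IsClosed (H1Sub : Set (C(unitInterval, ℝ) × L2)) := by
  have key : ∀ (x : unitInterval), Continuous (fun w : L2 => ∫ y in (0 : ℝ)..x, w y) := by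
    intro x
    have e : (fun w : L2 => ∫ y in (0 : ℝ)..x, w y) = fun w : L2 =>
        inner ℝ (indicatorConstLp 2 (measurableSet_Ioc (a := (0 : ℝ)) (b := x))
          (measure_ne_top (volume.restrict (Set.Icc (0 : ℝ) 1)) _) (1 : ℝ)) w := by
      funext w
      rw [L2.inner_indicatorConstLp_one, intervalIntegral.integral_of_le x.2.1,
        Measure.restrict_restrict measurableSet_Ioc, Set.inter_eq_left.2]
      exact fun y hy => ⟨hy.1.le, hy.2.trans x.2.2⟩
    rw [e]
    fun_prop
  have e : (H1Sub : Set (C(unitInterval, ℝ) × L2)) = ⋂ x : unitInterval,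
      {f | f.1 x = f.1 0 + ∫ y in (0 : ℝ)..x, f.2 y} := by
    ext f
    simp only [Set.mem_iInter]
    rfl
  rw [e]
  refine isClosed_iInter fun x => isClosed_eq ?_ ?_
  · exact (continuous_eval_const x).comp continuous_fst
  · exact ((continuous_eval_const 0).comp continuous_fst).add
      ((key x).comp continuous_snd)

/-- The Sobolev space `H¹([0,1]; ℝ)`, as a type. -/
def H1 : Type := H1Sub

instance : NormedAddCommGroup H1 := inferInstanceAs (NormedAddCommGroup H1Sub)

instance : NormedSpace ℝ H1 := inferInstanceAs (NormedSpace ℝ H1Sub)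

instance : CompleteSpace H1 := H1Sub_isClosed.completeSpace_coe

/-- The continuous function on `[0,1]` underlying an `H¹` function. -/
def H1.fn (f : H1) : C(unitInterval, ℝ) := f.1.1

/-- The derivative in `L²` of an `H¹` function. -/
def H1.deriv (f : H1) : L2 := f.1.2

/-- The element `w` of `L²` is (the class of) the `H¹` function `f`. -/
def H1.Represents (f : H1) (w : L2) : Prop :=
  ∀ᵐ x ∂(volume.restrict (Set.Icc (0 : ℝ) 1)), w x = Set.IccExtend zero_le_one f.fn x

/-- The state space `𝓗`: quadruples `(u, uₜ, v, vₜ) ∈ H¹ × L² × H¹ × L²` with `u(1) = v(0)`. -/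
def StateSub : Submodule ℝ (H1 × L2 × H1 × L2) where
  carrier := {z | H1.fn z.1 1 = H1.fn z.2.2.1 0}
  add_mem' := by
    intro a b ha hb
    exact congrArg₂ (· + ·) ha hb
  zero_mem' := rfl
  smul_mem' := by
    intro a b hb
    exact congrArg (a * ·) hb

theorem StateSub_isClosed : IsClosed (StateSub : Set (H1 × L2 × H1 × L2)) := by
  have hc : ∀ x : unitInterval, Continuous (fun f : H1 => f.fn x) := fun x =>
    (continuous_eval_const x).comp (continuous_fst.comp continuous_subtype_val)
  exact isClosed_eq ((hc 1).comp continuous_fst)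
    ((hc 0).comp (continuous_fst.comp (continuous_snd.comp continuous_snd)))

/-- The state space `𝓗`, as a type. -/
def StateSpace : Type := StateSub

instance : NormedAddCommGroup StateSpace := inferInstanceAs (NormedAddCommGroup StateSub)

instance : NormedSpace ℝ StateSpace := inferInstanceAs (NormedSpace ℝ StateSub)

/-- `𝓗` is complete, so that the Bochner integral of an `𝓗`-valued function is meaningful. -/
instance : CompleteSpace StateSpace := StateSub_isClosed.completeSpace_coe

namespace StateSpace

/-- The position `u` of the string. -/
def u (z : StateSpace) : H1 := z.1.1

/-- The velocity `uₜ` of the string. -/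
def ut (z : StateSpace) : L2 := z.1.2.1

/-- The position `v` of the controller. -/
def v (z : StateSpace) : H1 := z.1.2.2.1

/-- The velocity `vₜ` of the controller. -/
def vt (z : StateSpace) : L2 := z.1.2.2.2

/-- The norm `‖z‖_{𝓗₀}`, with
`‖z‖²_{𝓗₀} = c₁²‖uₓ‖² + ‖uₜ‖² + c₂²‖vₓ‖² + ‖vₜ‖² + v(1)²`. -/
def normH0 (c₁ c₂ : ℝ) (z : StateSpace) : ℝ :=
  Real.sqrt (c₁ ^ 2 * ‖z.u.deriv‖ ^ 2 + ‖z.ut‖ ^ 2 + c₂ ^ 2 * ‖z.v.deriv‖ ^ 2 + ‖z.vt‖ ^ 2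
    + z.v.fn 1 ^ 2)

end StateSpace

/-- The graph of the operator of the closed loop: `z = (u, p, v, r)` lies in the domain and is
mapped to `w = (p, c₁² uₓₓ, r, c₂² vₓₓ)`. Membership in the domain means that `uₓ`, `vₓ`, `p`, `r`
are in `H¹`, that `p(1) = r(0)` (part of `w ∈ 𝓗`), and that
`uₓ(0) = g p(0)`, `vₓ(0) = uₓ(1)`, `vₓ(1) = -h r(1) - q v(1)`. -/
def ClosedLoopGraph (c₁ c₂ g h q : ℝ) (z w : StateSpace) : Prop :=
  w.u.Represents z.ut ∧ w.v.Represents z.vt ∧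
  ∃ ux vx : H1,
    ux.Represents z.u.deriv ∧ vx.Represents z.v.deriv ∧
    w.ut = c₁ ^ 2 • ux.deriv ∧ w.vt = c₂ ^ 2 • vx.deriv ∧
    ux.fn 0 = g * w.u.fn 0 ∧
    vx.fn 0 = ux.fn 1 ∧
    vx.fn 1 = -h * w.v.fn 1 - q * z.v.fn 1

/-- `z` is the (mild) solution on `[0, ∞)` of the closed loop
`uₜₜ = c₁² uₓₓ`, `uₓ(0,t) = g uₜ(0,t)`, `u(1,t) = v(0,t)`,
`vₜₜ = c₂² vₓₓ`, `vₓ(0,t) = uₓ(1,t)`, `vₓ(1,t) = -h vₜ(1,t) - q v(1,t)`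
with initial state `z₀`: a continuous `𝓗`-valued function such that, `A` being the operator of the
closed loop, `∫₀ᵗ z(s) ds` is in the domain of `A` and `z(t) = z₀ + A ∫₀ᵗ z(s) ds` for `t ≥ 0`. -/
structure IsSolution (c₁ c₂ g h q : ℝ) (z₀ : StateSpace) (z : ℝ → StateSpace) : Prop where
  continuousOn : ContinuousOn z (Set.Ici 0)
  initial : z 0 = z₀
  equation : ∀ t : ℝ, 0 ≤ t →
    ClosedLoopGraph c₁ c₂ g h q (∫ s in (0 : ℝ)..t, z s) (z t - z₀)

/-- `H_{c₁, c₁g}`, where the argument `k` stands for `c₁g`. -/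
def Hmat (c₁ c₂ h q k : ℝ) : Matrix (Fin 4) (Fin 5) ℝ :=
  !![0, c₁, 1, 0, 0;
     1 - k, 0, 0, 0, 0;
     0, 0, 0, 1 - c₂ * h, -c₂ * q;
     0, -c₂, 1, 0, 0]

/-- `G_{c₁, c₁g}`, where the argument `k` stands for `c₁g`. -/
def Gmat (c₁ c₂ h q k : ℝ) : Matrix (Fin 4) (Fin 5) ℝ :=
  !![1 + k, 0, 0, 0, 0;
     0, -c₁, 1, 0, 0;
     0, c₂, 1, 0, 0;
     0, 0, 0, 1 + c₂ * h, c₂ * q]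

def Qmat (α S₅ : ℝ) : Matrix (Fin 5) (Fin 5) ℝ :=
  !![0, 0, 0, 0, 0;
     0, 0, 0, 0, 0;
     0, 0, 0, 0, 0;
     0, 0, 0, 0, S₅;
     0, 0, 0, S₅, 2 * α * S₅]

def Emat (c₁ c₂ α x : ℝ) : Matrix (Fin 4) (Fin 4) ℝ :=
  Matrix.diagonal ![Real.exp (2 * α * x * c₁⁻¹), Real.exp (2 * α * x * c₁⁻¹),
    Real.exp (2 * α * x * c₂⁻¹), Real.exp (2 * α * x * c₂⁻¹)]

/-- `Ψ_{c₁, k}(α) = Hᵀ E_α(1) S H - Gᵀ S G + Q_α` with `S = diag(S₁, S₂, S₃, S₄)`. -/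
def Psi (c₁ c₂ h q k S₁ S₂ S₃ S₄ S₅ α : ℝ) : Matrix (Fin 5) (Fin 5) ℝ :=
  (Hmat c₁ c₂ h q k).transpose * Emat c₁ c₂ α 1 * Matrix.diagonal ![S₁, S₂, S₃, S₄]
      * Hmat c₁ c₂ h q k
    - (Gmat c₁ c₂ h q k).transpose * Matrix.diagonal ![S₁, S₂, S₃, S₄] * Gmat c₁ c₂ h q k
    + Qmat α S₅

end

end WaveLoop

open MeasureTheory Filter Topology
open scoped RealInnerProductSpace

namespace WaveLoop

/-! The characteristic variables `uₜ ± c₁uₓ` and `vₜ ± c₂vₓ` are transported across the interval.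
Give each of their squares an affine weight equal to `1` at the outflow end and `1 + ε` at the
inflow end, and add `S₅ v(1)²`. The resulting inner product is equivalent to that of the state
space: `v(1)²` controls `v`, and `u(1) = v(0)` then controls `u`.

Integration by parts (`weightedInner_char`) turns `2⟨z, A z⟩` into three terms: the quadratic form
of `Ψ(0)` in the boundary values, `ε` times the squared inflow values, and minus `ε` times the
squared norms of the characteristic variables (`two_mul_energyForm_eq`). Strict negativity of `Ψ(0)`
absorbs the second term for small `ε` and still leaves a multiple of `-v(1)²`. With the third term
this yields `⟨z, A z⟩ ≤ -α⟨z, z⟩` (`exists_energyForm_le`). Affine weights make a continuity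
argument in `Ψ(α)` unnecessary.

The operator `A` is onto, because its equation can be integrated explicitly, with a division by `q`
fixing the last constant (`exists_closedLoopGraph`). It is injective by dissipativity. Hence it has
a linear inverse `R`, and everything is phrased through `R`: a mild solution satisfies `R (z t - z₀)
= ∫ z`, and dissipativity reads `⟨R w, w⟩ ≤ -α‖R w‖²`. This inequality bounds `R`, makes its range
dense, gives decay and uniqueness of mild solutions (`IsMild.norm_le`), and gives existence by
Yosida approximation (`exists_isMild`). `exists_isMild_and_decay` transfers these conclusions to the
original norm. -/

theorem uniformCauchySeqOn_of_norm_sub_le {E : Type*} [NormedAddCommGroup E]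
    {z : ℕ → ℝ → E} {S : Set ℝ} {b : ℕ → ℕ → ℝ}
    (hb : Tendsto (fun p : ℕ × ℕ => b p.1 p.2) atTop (𝓝 0))
    (h : ∀ m n, ∀ t ∈ S, ‖z m t - z n t‖ ≤ b m n) : UniformCauchySeqOn z atTop S := by
  rw [Metric.uniformCauchySeqOn_iff]
  intro ε hε
  obtain ⟨⟨N, M⟩, hN⟩ := eventually_atTop.1 (hb.eventually_lt_const hε)
  refine ⟨max N M, fun m hm n hn t ht => ?_⟩
  rw [dist_eq_norm]
  exact (h m n t ht).trans_lt
    (hN (m, n) ⟨(le_max_left _ _).trans hm, (le_max_right _ _).trans hn⟩)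

/-- `z` is a mild solution on `[0, ∞)` of `z' = R⁻¹ z` with initial state `z₀`. -/
structure IsMild {E : Type*} [NormedAddCommGroup E] [NormedSpace ℝ E] (R : E → E) (z₀ : E) (z : ℝ → E) : Prop where
  continuousOn : ContinuousOn z (Set.Ici 0)
  equation : ∀ t : ℝ, 0 ≤ t → R (z t - z₀) = ∫ s in (0 : ℝ)..t, z s

/-! ### Mild solutions expressed through the inverse of the generator -/

section MildSolution

variable {E : Type*} [NormedAddCommGroup E] [NormedSpace ℝ E]

theorem IsMild.congr {R : E → E} {z₀ : E} {z z' : ℝ → E} (hz : IsMild R z₀ z)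
    (h : Set.EqOn z' z (Set.Ici 0)) : IsMild R z₀ z' where
  continuousOn := hz.continuousOn.congr h
  equation t ht := by
    rw [h ht, hz.equation t ht]
    refine intervalIntegral.integral_congr fun s hs => ?_
    rw [Set.uIcc_of_le ht] at hs
    exact (h hs.1).symm

theorem IsMild.exists_continuous {R : E → E} {z₀ : E} {z : ℝ → E} (hz : IsMild R z₀ z) :
    ∃ z' : ℝ → E, Continuous z' ∧ IsMild R z₀ z' ∧ Set.EqOn z' z (Set.Ici 0) := by
  have e : Set.EqOn (fun t => z (max t 0)) z (Set.Ici 0) := fun t ht => by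
    simp [max_eq_left (Set.mem_Ici.1 ht)]
  refine ⟨fun t => z (max t 0), ?_, hz.congr e, e⟩
  exact hz.continuousOn.comp_continuous (by fun_prop) fun t =>
    Set.mem_Ici.2 (le_max_right t 0)

theorem IsMild.integrable {R : E → E} {z₀ : E} {z : ℝ → E} (hz : IsMild R z₀ z)
    {t : ℝ} (ht : 0 ≤ t) : IntervalIntegrable z volume 0 t := by
  apply ContinuousOn.intervalIntegrable
  rw [Set.uIcc_of_le ht]
  exact hz.continuousOn.mono Set.Icc_subset_Ici_self

theorem IsMild.sub {R : E → E} {z₀ z₀' : E} {z z' : ℝ → E} (hz : IsMild R z₀ z)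
    (hR : ∀ x y, R (x - y) = R x - R y) (hz' : IsMild R z₀' z') : IsMild R (z₀ - z₀') (fun t => z t - z' t) where
  continuousOn := hz.continuousOn.sub hz'.continuousOn
  equation t ht := by
    rw [intervalIntegral.integral_sub (hz.integrable ht) (hz'.integrable ht),
      ← hz.equation t ht, ← hz'.equation t ht, ← hR]
    congr 1
    abel

theorem IsMild.initial {R : E → E} (hinj : ∀ w, R w = 0 → w = 0) {z₀ : E} {z : ℝ → E}
    (hz : IsMild R z₀ z) : z 0 = z₀ := by
  have := hz.equation 0 le_rfl
  rw [intervalIntegral.integral_same] at this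
  exact sub_eq_zero.1 (hinj _ this)

end MildSolution

/-! ### Decay and limits of mild solutions -/

section Dissipative

variable {E : Type*} [NormedAddCommGroup E] [InnerProductSpace ℝ E]

/-- A mild solution decays at the rate at which the generator is dissipative. -/
theorem IsMild.norm_le [CompleteSpace E] {R : E →L[ℝ] E} {α : ℝ}
    (hR : ∀ w, ⟪R w, w⟫ ≤ -α * ‖R w‖ ^ 2) (hinj : ∀ w, R w = 0 → w = 0)
    {z₀ : E} {z : ℝ → E} (hz : IsMild R z₀ z) {t : ℝ} (ht : 0 ≤ t) :
    ‖z t‖ ≤ Real.exp (-α * t) * ‖z₀‖ := by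
  obtain ⟨y, hyc, hy, hyz⟩ := hz.exists_continuous
  have hy0 := hy.initial hinj
  rw [← hyz ht]
  clear hyz hz z
  have hd : ∀ s, HasDerivAt (fun s => ∫ r in (0 : ℝ)..s, y r) (y s) s := fun s =>
    intervalIntegral.integral_hasDerivAt_right (hyc.intervalIntegrable _ _)
      (hyc.stronglyMeasurableAtFilter _ _) hyc.continuousAt
  set Y : ℝ → E := fun s => ∫ r in (0 : ℝ)..s, y r with hY
  -- the averages `Y (s + h) - Y s` are classical solutions
  have step : ∀ h : ℝ, 0 < h →
      ‖Y (t + h) - Y t‖ ≤ Real.exp (-α * t) * ‖Y (0 + h) - Y 0‖ := by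
    intro h hh
    set D : ℝ → E := fun s => Y (s + h) - Y s with hDdef
    have hD : ∀ s, HasDerivAt D (y (s + h) - y s) s := fun s =>
      ((hd (s + h)).comp_add_const s h).sub (hd s)
    have hRD : ∀ s, 0 ≤ s → D s = R (y (s + h) - y s) := by
      intro s hs
      simp only [hDdef, hY]
      rw [← hy.equation s hs, ← hy.equation (s + h) (by linarith), ← map_sub]
      congr 1
      abel
    -- Since `D = R D'` on `[0, ∞)`, the hypothesis `hR` at `D'` says `⟪D, D'⟫ ≤ -α‖D‖²`, so this
    -- product is nonincreasing there.
    have hder : ∀ s, HasDerivAt (fun s => Real.exp (2 * α * s) * ‖D s‖ ^ 2)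
        (Real.exp (2 * α * s) * (2 * α) * ‖D s‖ ^ 2
          + Real.exp (2 * α * s) * (2 * ⟪D s, y (s + h) - y s⟫)) s := by
      intro s
      have h1 : HasDerivAt (fun s : ℝ => Real.exp (2 * α * s)) (Real.exp (2 * α * s) * (2 * α)) s := by
        simpa using ((hasDerivAt_id s).const_mul (2 * α)).exp
      exact h1.mul (hD s).norm_sq
    have hanti : AntitoneOn (fun s => Real.exp (2 * α * s) * ‖D s‖ ^ 2) (Set.Ici 0) := by
      refine antitoneOn_of_deriv_nonpos (convex_Ici 0)
        (fun s _ => (hder s).continuousAt.continuousWithinAt)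
        (fun s _ => (hder s).differentiableAt.differentiableWithinAt) ?_
      intro s hs
      rw [interior_Ici] at hs
      rw [(hder s).deriv]
      have h2 := hR (y (s + h) - y s)
      rw [← hRD s hs.le] at h2
      have := mul_le_mul_of_nonneg_left h2 (Real.exp_pos (2 * α * s)).le
      linarith
    have h3 := hanti (Set.mem_Ici.2 le_rfl) (Set.mem_Ici.2 ht) ht
    simp only [mul_zero, Real.exp_zero, one_mul] at h3
    refine (pow_le_pow_iff_left₀ (norm_nonneg _) (by positivity) two_ne_zero).1 ?_
    rw [mul_pow, ← Real.exp_nat_mul]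
    have h4 := mul_le_mul_of_nonneg_left h3 (Real.exp_pos (-(2 * α * t))).le
    rw [← mul_assoc, ← Real.exp_add, neg_add_cancel, Real.exp_zero, one_mul] at h4
    convert h4 using 3
    push_cast
    ring
  -- Dividing the estimate for the averages by `h` and letting `h ↓ 0` recovers the estimate for
  -- `y`, which need not be differentiable.
  have lim : ∀ s : ℝ, Tendsto (fun h : ℝ => ‖h⁻¹ • (Y (s + h) - Y s)‖) (𝓝[>] 0) (𝓝 ‖y s‖) :=
    fun s => (((hasDerivAt_iff_tendsto_slope_zero.1 (hd s)).mono_left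
      (nhdsWithin_mono _ fun x hx => ne_of_gt hx))).norm
  have := le_of_tendsto_of_tendsto (lim t) ((lim 0).const_mul (Real.exp (-α * t))) (by
    filter_upwards [self_mem_nhdsWithin] with h hh
    rw [norm_smul, norm_smul, mul_left_comm]
    exact mul_le_mul_of_nonneg_left (step h hh) (norm_nonneg _))
  rwa [hy0] at this

/-- Mild solutions pass to locally uniform limits. -/
theorem exists_isMild_of_uniformCauchySeqOn [CompleteSpace E] {K : ℕ → E →L[ℝ] E} {R : E →L[ℝ] E}
    {x : ℕ → E} {z₀ : E} {z : ℕ → ℝ → E} (hz : ∀ n, IsMild (K n) (x n) (z n))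
    (hK : Tendsto K atTop (𝓝 R)) (hx : Tendsto x atTop (𝓝 z₀))
    (hC : ∀ T : ℝ, UniformCauchySeqOn z atTop (Set.Icc 0 T)) : ∃ z', IsMild R z₀ z' := by
  have hlim : ∀ t : ℝ, ∃ y, 0 ≤ t → Tendsto (fun n => z n t) atTop (𝓝 y) := by
    intro t
    by_cases ht : 0 ≤ t
    · obtain ⟨y, hy⟩ := cauchySeq_tendsto_of_complete ((hC t).cauchySeq (x := t) ⟨ht, le_rfl⟩)
      exact ⟨y, fun _ => hy⟩
    · exact ⟨0, fun h => absurd h ht⟩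
  choose y hy using hlim
  have hU : ∀ T : ℝ, TendstoUniformlyOn z y atTop (Set.Icc 0 T) := fun T =>
    (hC T).tendstoUniformlyOn_of_tendsto fun t ht => hy t ht.1
  have hyc : ContinuousOn y (Set.Ici 0) := by
    intro t ht
    have h1 : ContinuousOn y (Set.Icc 0 (t + 1)) := (hU (t + 1)).continuousOn
      (Frequently.of_forall fun n => (hz n).continuousOn.mono Set.Icc_subset_Ici_self)
    refine (h1 t ⟨ht, by linarith⟩).mono_of_mem_nhdsWithin ?_
    rw [← Set.Ici_inter_Iic]
    exact inter_mem self_mem_nhdsWithin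
      (mem_nhdsWithin_of_mem_nhds (Iic_mem_nhds (by linarith)))
  refine ⟨y, hyc, fun t ht => ?_⟩
  have h1 : Tendsto (fun n => K n (z n t - x n)) atTop (𝓝 (R (y t - z₀))) :=
    
    (isBoundedBilinearMap_apply.continuous.tendsto (R, y t - z₀)).comp
      (hK.prodMk_nhds ((hy t ht).sub hx))
  refine tendsto_nhds_unique h1 ?_
  simp only [fun n => (hz n).equation t ht]
  refine TendstoUniformlyOn.tendsto_intervalIntegral_of_continuousOn (.of_forall fun n => ?_) ?_
  · rw [Set.uIcc_of_le ht]
    exact (hz n).continuousOn.mono Set.Icc_subset_Ici_self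
  · rw [Set.uIcc_of_le ht]
    exact hU t

end Dissipative

/-! ### Yosida approximation and generation -/

/-- The difference of two approximate solutions is `R (w - w') - (ε w - ε' w')`. Paired with its
derivative `w - w'`, the first part is nonpositive and the second is at most `(ε + ε') M · 2M`. This
is the Cauchy estimate as `ε, ε' → 0`. -/
theorem norm_sub_sq_le_of_yosida {E : Type*} [NormedAddCommGroup E] [InnerProductSpace ℝ E]
    {R : E →L[ℝ] E} (hR : ∀ w, ⟪R w, w⟫ ≤ 0) {ε ε' M : ℝ}
    (hε : 0 ≤ ε) (hε' : 0 ≤ ε') {z w z' w' : ℝ → E}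
    (hz : ∀ t, HasDerivAt z (w t) t) (hz' : ∀ t, HasDerivAt z' (w' t) t) (h0 : z 0 = z' 0)
    (hw : ∀ t, z t = R (w t) - ε • w t) (hw' : ∀ t, z' t = R (w' t) - ε' • w' t)
    (hM : ∀ t, 0 ≤ t → ‖w t‖ ≤ M) (hM' : ∀ t, 0 ≤ t → ‖w' t‖ ≤ M) {t : ℝ} (ht : 0 ≤ t) :
    ‖z t - z' t‖ ^ 2 ≤ 4 * M ^ 2 * (ε + ε') * t := by
  have hd : ∀ s, HasDerivAt (fun s => ‖z s - z' s‖ ^ 2 - 4 * M ^ 2 * (ε + ε') * s)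
      (2 * ⟪z s - z' s, w s - w' s⟫ - 4 * M ^ 2 * (ε + ε')) s := fun s => by
    have h1 := ((hz s).sub (hz' s)).norm_sq.sub
      ((hasDerivAt_id s).const_mul (4 * M ^ 2 * (ε + ε')))
    rw [mul_one] at h1
    exact h1
  have hanti : AntitoneOn (fun s => ‖z s - z' s‖ ^ 2 - 4 * M ^ 2 * (ε + ε') * s) (Set.Ici 0) := by
    refine antitoneOn_of_deriv_nonpos (convex_Ici 0)
      (fun s _ => (hd s).continuousAt.continuousWithinAt)
      (fun s _ => (hd s).differentiableAt.differentiableWithinAt) fun s hs => ?_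
    rw [interior_Ici] at hs
    rw [(hd s).deriv]
    have hMs := hM s (le_of_lt hs)
    have hMs' := hM' s (le_of_lt hs)
    have hM0 : 0 ≤ M := (norm_nonneg _).trans hMs
    have e : z s - z' s = R (w s - w' s) - (ε • w s - ε' • w' s) := by
      rw [hw, hw', map_sub]
      abel
    have h1 : ‖ε • w s - ε' • w' s‖ ≤ (ε + ε') * M := by
      refine (norm_sub_le _ _).trans ?_
      rw [norm_smul, norm_smul, Real.norm_of_nonneg hε, Real.norm_of_nonneg hε', add_mul]
      gcongr
    have h2 : ‖w s - w' s‖ ≤ 2 * M := (norm_sub_le _ _).trans (by linarith)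
    have h3 := (abs_le.1 (abs_real_inner_le_norm (ε • w s - ε' • w' s) (w s - w' s))).1
    have h4 : ‖ε • w s - ε' • w' s‖ * ‖w s - w' s‖ ≤ ((ε + ε') * M) * (2 * M) :=
      mul_le_mul h1 h2 (norm_nonneg _) (by positivity)
    rw [e, inner_sub_left]
    nlinarith [hR (w s - w' s)]
  have := hanti (Set.mem_Ici.2 le_rfl) (Set.mem_Ici.2 ht) ht
  simp only [h0, sub_self, norm_zero, mul_zero] at this
  linarith

section Yosida

variable {E : Type*} [NormedAddCommGroup E] [InnerProductSpace ℝ E] [CompleteSpace E]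

/-- Lax–Milgram: dissipativity makes the form of `ε - R` coercive with constant `ε`. The inverse `A`
of `R - ε` is the bounded Yosida approximation of the generator `R⁻¹`. -/
theorem exists_inverse_sub_smul {R : E →L[ℝ] E} (hR : ∀ w, ⟪R w, w⟫ ≤ 0) {ε : ℝ} (hε : 0 < ε) :
    ∃ A : E →L[ℝ] E, (∀ y, R (A y) - ε • A y = y) ∧ ∀ y, A (R y - ε • y) = y := by
  have hco : IsCoercive ((innerSL ℝ).comp (ε • ContinuousLinearMap.id ℝ E - R)) := by
    refine ⟨ε, hε, fun w => ?_⟩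
    have h1 : ((innerSL ℝ).comp (ε • ContinuousLinearMap.id ℝ E - R)) w w
        = ε * (‖w‖ * ‖w‖) - ⟪R w, w⟫ := by
      simp [← real_inner_self_eq_norm_mul_norm]
    rw [h1]
    linarith [hR w]
  have he : ∀ w, hco.continuousLinearEquivOfBilin w = ε • w - R w := fun w =>
    (hco.unique_continuousLinearEquivOfBilin fun y => by
      simp [inner_sub_left, real_inner_smul_left, innerSL_apply_apply ℝ w y]).symm
  refine ⟨-(hco.continuousLinearEquivOfBilin.symm : E →L[ℝ] E), fun y => ?_, fun y => ?_⟩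
  · have := he (hco.continuousLinearEquivOfBilin.symm y)
    rw [ContinuousLinearEquiv.apply_symm_apply] at this
    conv_rhs => rw [this]
    simp only [neg_apply, ContinuousLinearEquiv.coe_coe, map_neg, smul_neg]
    abel
  · rw [← neg_sub (ε • y), ← he y, neg_apply, map_neg, neg_neg]
    exact hco.continuousLinearEquivOfBilin.symm_apply_apply y

/-- The Yosida approximation of `z' = R⁻¹ z`, started in the range of `R`. -/
theorem exists_yosida_approximation {R : E →L[ℝ] E} (hR : ∀ w, ⟪R w, w⟫ ≤ 0) {ε : ℝ}
    (hε : 0 < ε) (x : E) :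
    ∃ z w : ℝ → E, (∀ t, HasDerivAt z (w t) t) ∧ z 0 = R x ∧ Continuous w ∧
      (∀ t, z t = R (w t) - ε • w t) ∧ ∀ t, 0 ≤ t → ‖w t‖ ≤ 2 * ‖x‖ := by
  obtain ⟨A, hA, hA'⟩ := exists_inverse_sub_smul hR hε
  have hder : ∀ (y : E) (t : ℝ), HasDerivAt (fun t : ℝ => NormedSpace.exp (t • A) y)
      (A (NormedSpace.exp (t • A) y)) t := fun y t => by
    have := (hasDerivAt_exp_smul_const' A t).clm_apply (hasDerivAt_const t y)
    simpa using this
  have hder' : ∀ (y : E) (t : ℝ), HasDerivAt (fun t : ℝ => NormedSpace.exp (t • A) y)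
      (NormedSpace.exp (t • A) (A y)) t := fun y t => by
    have := (hasDerivAt_exp_smul_const A t).clm_apply (hasDerivAt_const t y)
    simpa using this
  have hcomm : ∀ (y : E) (t : ℝ), NormedSpace.exp (t • A) (A y) = A (NormedSpace.exp (t • A) y) :=
    fun y t => (hder' y t).unique (hder y t)
  -- Substituting `v = R (A v) - ε A v` shows that `A` inherits dissipativity from `R`, so its
  -- exponential is a contraction for nonnegative times.
  have hin : ∀ v, ⟪v, A v⟫ = ⟪R (A v), A v⟫ - ε * ‖A v‖ ^ 2 := fun v => by
    have := congrArg (fun y => ⟪y, A v⟫) (hA v)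
    simp only [inner_sub_left, real_inner_smul_left, real_inner_self_eq_norm_sq] at this
    exact this.symm
  have hcontr : ∀ (y : E) (t : ℝ), 0 ≤ t → ‖NormedSpace.exp (t • A) y‖ ≤ ‖y‖ := by
    intro y t ht
    have hanti : AntitoneOn (fun t : ℝ => ‖NormedSpace.exp (t • A) y‖ ^ 2) (Set.Ici 0) := by
      refine antitoneOn_of_deriv_nonpos (convex_Ici 0)
        (fun s _ => (hder y s).norm_sq.continuousAt.continuousWithinAt)
        (fun s _ => (hder y s).norm_sq.differentiableAt.differentiableWithinAt) fun s _ => ?_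
      rw [(hder y s).norm_sq.deriv]
      set v := NormedSpace.exp (s • A) y
      rw [hin v]
      nlinarith [hR (A v), sq_nonneg ‖A v‖]
    have := hanti (Set.mem_Ici.2 le_rfl) (Set.mem_Ici.2 ht) ht
    simp only [zero_smul, NormedSpace.exp_zero, one_apply_eq_self] at this
    exact (pow_le_pow_iff_left₀ (norm_nonneg _) (norm_nonneg _) two_ne_zero).1 this
  -- Starting in the range of `R` keeps the initial velocity bounded independently of `ε`: it equals
  -- `x + ε A x`, and `‖ε A x‖ ≤ ‖x‖` by `hin` and Cauchy–Schwarz.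
  have hAx : ‖A (R x)‖ ≤ 2 * ‖x‖ := by
    have h1 : A (R x) = x + ε • A x := by
      have := hA' x
      rw [map_sub, map_smul] at this
      rw [← sub_eq_iff_eq_add]
      exact this
    have h2 : ε * ‖A x‖ ≤ ‖x‖ := by
      have h3 := hin x
      have h4 := (abs_le.1 (abs_real_inner_le_norm x (A x))).1
      rcases (norm_nonneg (A x)).eq_or_lt with h0 | h0
      · rw [← h0]
        simp
      · refine le_of_mul_le_mul_right ?_ h0
        nlinarith [hR (A x)]
    calc ‖A (R x)‖ ≤ ‖x‖ + ‖ε • A x‖ := by rw [h1]; exact norm_add_le _ _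
      _ ≤ 2 * ‖x‖ := by rw [norm_smul, Real.norm_of_nonneg hε.le]; linarith
  refine ⟨fun t => NormedSpace.exp (t • A) (R x), fun t => NormedSpace.exp (t • A) (A (R x)),
    hder' (R x), by simp, ?_, fun t => ?_, fun t ht => (hcontr _ t ht).trans hAx⟩
  · exact continuous_iff_continuousAt.2 fun t => (hder _ t).continuousAt
  · simp only [hcomm, hA]

/-- The Yosida approximations with `ε = 1/(n+1)` are mild solutions for `R - ε`. By
`norm_sub_sq_le_of_yosida` they are uniformly Cauchy on bounded time intervals, and `R - ε → R` in
operator norm. -/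
theorem exists_isMild_of_mem_range {R : E →L[ℝ] E} (hR : ∀ w, ⟪R w, w⟫ ≤ 0) (x : E) :
    ∃ z, IsMild R (R x) z := by
  have hε : ∀ n : ℕ, (0 : ℝ) < 1 / ((n : ℝ) + 1) := fun n => Nat.one_div_pos_of_nat
  choose z w hz h0 hwc hw hM using fun n : ℕ => exists_yosida_approximation hR (hε n) x
  have hlim : Tendsto (fun n : ℕ => (1 : ℝ) / ((n : ℝ) + 1)) atTop (𝓝 0) :=
    tendsto_one_div_add_atTop_nhds_zero_nat
  refine exists_isMild_of_uniformCauchySeqOn (z := z) (x := fun _ => R x)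
    (K := fun n => R - (1 / ((n : ℝ) + 1)) • ContinuousLinearMap.id ℝ E)
    (fun n => ⟨?_, fun t ht => ?_⟩) ?_ tendsto_const_nhds fun T => ?_
  · exact fun t _ => (hz n t).continuousAt.continuousWithinAt
  · have h1 : ∫ s in (0 : ℝ)..t, w n s = z n t - R x := by
      rw [intervalIntegral.integral_eq_sub_of_hasDerivAt (fun s _ => hz n s)
        ((hwc n).intervalIntegrable _ _), h0]
    rw [← h1, ← ContinuousLinearMap.intervalIntegral_comp_comm _
      ((hwc n).intervalIntegrable _ _)]
    refine intervalIntegral.integral_congr fun s _ => ?_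
    simp [hw n s]
  · simpa using (tendsto_const_nhds (x := R)).sub
      (hlim.smul_const (ContinuousLinearMap.id ℝ E))
  · refine uniformCauchySeqOn_of_norm_sub_le (b := fun m n =>
      Real.sqrt (4 * (2 * ‖x‖) ^ 2 * (1 / ((m : ℝ) + 1) + 1 / ((n : ℝ) + 1)) * T)) ?_ ?_
    · have h1 : Tendsto (fun p : ℕ × ℕ => (1 : ℝ) / ((p.1 : ℝ) + 1) + 1 / ((p.2 : ℝ) + 1))
          atTop (𝓝 0) := by
        rw [← prod_atTop_atTop_eq]
        simpa using (hlim.comp tendsto_fst).add (hlim.comp tendsto_snd)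
      simpa using ((h1.const_mul (4 * (2 * ‖x‖) ^ 2)).mul_const T).sqrt
    · intro m n t ht
      apply Real.le_sqrt_of_sq_le
      refine (norm_sub_sq_le_of_yosida hR (hε m).le (hε n).le (hz m) (hz n)
        ((h0 m).trans (h0 n).symm) (hw m) (hw n) (hM m) (hM n) ht.1).trans ?_
      have := hε m
      have := hε n
      exact mul_le_mul_of_nonneg_left ht.2 (by positivity)

/-- A vector `y` orthogonal to the range has `⟪R y, y⟫ = 0`, so strict dissipativity forces `R y =
0`, and then injectivity forces `y = 0`. -/
theorem denseRange_of_inner_le {R : E →L[ℝ] E} {α : ℝ} (hα : 0 < α)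
    (hR : ∀ w, ⟪R w, w⟫ ≤ -α * ‖R w‖ ^ 2) (hinj : ∀ w, R w = 0 → w = 0) : DenseRange R := by
  have h1 : R.range.topologicalClosure = ⊤ := by
    rw [Submodule.topologicalClosure_eq_top_iff, Submodule.eq_bot_iff]
    intro y hy
    have h2 : ⟪R y, y⟫ = 0 := hy _ ⟨y, rfl⟩
    have h3 := hR y
    rw [h2] at h3
    refine hinj y (norm_eq_zero.1 (pow_eq_zero_iff two_ne_zero |>.1 ?_))
    nlinarith [sq_nonneg ‖R y‖]
  intro y
  have : y ∈ R.range.topologicalClosure := by rw [h1]; trivial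
  exact this

/-- A dissipative operator with bounded inverse `R` generates a contraction semigroup. -/
theorem exists_isMild {R : E →L[ℝ] E} {α : ℝ} (hα : 0 < α)
    (hR : ∀ w, ⟪R w, w⟫ ≤ -α * ‖R w‖ ^ 2) (hinj : ∀ w, R w = 0 → w = 0) (z₀ : E) :
    ∃ z, IsMild R z₀ z := by
  have hR0 : ∀ w, ⟪R w, w⟫ ≤ 0 := fun w => (hR w).trans (by nlinarith [sq_nonneg ‖R w‖])
  obtain ⟨x, hx, hxl⟩ := mem_closure_iff_seq_limit.1 (denseRange_of_inner_le hα hR hinj z₀)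
  choose y hy using hx
  have : ∀ n, ∃ z, IsMild R (x n) z := fun n => by
    rw [← hy n]
    exact exists_isMild_of_mem_range hR0 _
  choose z hz using this
  refine exists_isMild_of_uniformCauchySeqOn hz tendsto_const_nhds hxl fun T =>
    uniformCauchySeqOn_of_norm_sub_le (b := fun m n => ‖x m - x n‖) ?_ fun m n t ht => ?_
  · rw [← prod_atTop_atTop_eq]
    simpa using ((hxl.comp tendsto_fst).sub (hxl.comp tendsto_snd)).norm
  -- A difference of mild solutions is mild, so decay bounds it by the distance of the initial
  -- states, uniformly in time.
  · refine (((hz m).sub (map_sub R) (hz n)).norm_le hR hinj ht.1).trans ?_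
    refine mul_le_of_le_one_left (norm_nonneg _) (Real.exp_le_one_iff.2 ?_)
    nlinarith [ht.1]

end Yosida

/-! ### Passage to an equivalent inner product -/

/-- The vector space `X` with the norm of the inner product `c`. -/
def Renorm {X : Type*} [AddCommGroup X] [Module ℝ X] (_c : InnerProductSpace.Core ℝ X) : Type _ := X

section Renorm

variable {X : Type*} [AddCommGroup X] [Module ℝ X] (c : InnerProductSpace.Core ℝ X)

noncomputable instance : NormedAddCommGroup (Renorm c) :=
  @InnerProductSpace.Core.toNormedAddCommGroup ℝ X _ _ _ c

noncomputable instance : InnerProductSpace ℝ (Renorm c) := InnerProductSpace.ofCore c.toCore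

/-- The identity map from `X` to its renorming. -/
def toRenorm : X ≃ₗ[ℝ] Renorm c where
  toFun x := x
  invFun x := x
  map_add' _ _ := rfl
  map_smul' _ _ := rfl
  left_inv _ := rfl
  right_inv _ := rfl

theorem inner_toRenorm (x y : X) : ⟪toRenorm c x, toRenorm c y⟫ = c.inner x y := rfl

theorem norm_toRenorm_sq (x : X) : ‖toRenorm c x‖ ^ 2 = c.inner x x := by
  rw [← real_inner_self_eq_norm_sq, inner_toRenorm]

end Renorm

/-- Only continuity and the Bochner integral enter the notion of a mild solution, so an equivalent
norm has the same mild solutions. -/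
theorem IsMild.map {X Y : Type*} [NormedAddCommGroup X] [NormedSpace ℝ X]
    [NormedAddCommGroup Y] [NormedSpace ℝ Y] (e : X ≃L[ℝ] Y) {R : X → X} {R' : Y → Y}
    (hR : ∀ x, R' (e x) = e (R x)) {z₀ : X} {z : ℝ → X} (hz : IsMild R z₀ z) :
    IsMild R' (e z₀) (fun t => e (z t)) where
  continuousOn := e.continuous.comp_continuousOn hz.continuousOn
  equation t ht := by
    rw [← map_sub, hR, hz.equation t ht, intervalIntegral.integral_of_le ht,
      intervalIntegral.integral_of_le ht]
    exact (e.integral_comp_comm z).symm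

/-- Generation of an exponentially stable semigroup by an operator with inverse `R` that is
dissipative for an equivalent inner product. -/
theorem exists_isMild_and_decay {X : Type*} [NormedAddCommGroup X] [NormedSpace ℝ X]
    [CompleteSpace X] (c : InnerProductSpace.Core ℝ X) {a b α : ℝ} (ha : 0 < a)
    (hα : 0 < α) (hac : ∀ x, a * ‖x‖ ^ 2 ≤ c.inner x x) (hcb : ∀ x, c.inner x x ≤ b * ‖x‖ ^ 2)
    (R : X →ₗ[ℝ] X) (hR : ∀ w, c.inner (R w) w ≤ -α * c.inner (R w) (R w))
    (hinj : ∀ w, R w = 0 → w = 0) :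
    (∀ z₀, ∃ z, IsMild R z₀ z) ∧ ∀ z₀ z, IsMild R z₀ z → ∀ t, 0 ≤ t →
      c.inner (z t) (z t) ≤ Real.exp (-α * t) ^ 2 * c.inner z₀ z₀ := by
  let e : X ≃L[ℝ] Renorm c := (toRenorm c).toContinuousLinearEquivOfBounds (Real.sqrt b)
    (Real.sqrt a⁻¹)
    (fun x => by
      rw [← Real.sqrt_sq (norm_nonneg (toRenorm c x)), ← Real.sqrt_sq (norm_nonneg x),
        ← Real.sqrt_mul' _ (sq_nonneg _), norm_toRenorm_sq]
      exact Real.sqrt_le_sqrt (hcb x))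
    (fun y => by
      obtain ⟨x, rfl⟩ := (toRenorm c).surjective y
      rw [LinearEquiv.symm_apply_apply, ← Real.sqrt_sq (norm_nonneg (toRenorm c x)),
        ← Real.sqrt_sq (norm_nonneg x), ← Real.sqrt_mul' _ (sq_nonneg _), norm_toRenorm_sq]
      refine Real.sqrt_le_sqrt ?_
      rw [inv_mul_eq_div, le_div_iff₀' ha]
      exact hac x)
  have hin : ∀ x y : X, ⟪e x, e y⟫ = c.inner x y := fun x y => rfl
  have hnorm : ∀ x : X, ‖e x‖ ^ 2 = c.inner x x := norm_toRenorm_sq c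
  have : CompleteSpace (Renorm c) :=
    (completeSpace_congr (e := e.toEquiv) e.isUniformEmbedding).1 inferInstance
  let R₀ : Renorm c →ₗ[ℝ] Renorm c := e.toLinearMap ∘ₗ R ∘ₗ e.symm.toLinearMap
  have hR₀ : ∀ x, R₀ (e x) = e (R x) := fun x => by simp [R₀]
  have hd : ∀ w, ⟪R₀ w, w⟫ ≤ -α * ‖R₀ w‖ ^ 2 := fun w => by
    obtain ⟨x, rfl⟩ := e.surjective w
    rw [hR₀, hin, hnorm]
    exact hR x
  -- Boundedness of the inverse is not assumed. It follows from `α‖R₀ w‖² ≤ -⟪R₀ w, w⟫ ≤ ‖R₀ w‖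
  -- ‖w‖`.
  have hbound : ∀ w, ‖R₀ w‖ ≤ α⁻¹ * ‖w‖ := fun w => by
    rw [inv_mul_eq_div, le_div_iff₀' hα]
    have h1 := hd w
    have h2 := (abs_le.1 (abs_real_inner_le_norm (R₀ w) w)).1
    rcases (norm_nonneg (R₀ w)).eq_or_lt with h0 | h0
    · rw [← h0]
      simp
    · refine le_of_mul_le_mul_left ?_ h0
      nlinarith
  let R' : Renorm c →L[ℝ] Renorm c := R₀.mkContinuous α⁻¹ hbound
  have hR' : ∀ x, R' (e x) = e (R x) := hR₀
  have hinj' : ∀ w, R' w = 0 → w = 0 := fun w hw => by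
    obtain ⟨x, rfl⟩ := e.surjective w
    rw [hR', map_eq_zero_iff e e.injective] at hw
    rw [hinj x hw, map_zero]
  refine ⟨fun z₀ => ?_, fun z₀ z hz t ht => ?_⟩
  · obtain ⟨z, hz⟩ := exists_isMild (R := R') hα hd hinj' (e z₀)
    have := hz.map e.symm (R' := R) fun x => by
      obtain ⟨y, rfl⟩ := e.surjective x
      rw [hR', e.symm_apply_apply, e.symm_apply_apply]
    rw [e.symm_apply_apply] at this
    exact ⟨_, this⟩
  · have := (hz.map e (R' := R') hR').norm_le (R := R') hd hinj' ht
    have := pow_le_pow_left₀ (norm_nonneg _) this 2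
    rwa [mul_pow, hnorm, hnorm] at this

-- Affinely weighted forms on `L²`

local notation "μ₀₁" => volume.restrict (Set.Icc (0 : ℝ) 1)

theorem integral_unitInterval (f : ℝ → ℝ) : ∫ x, f x ∂μ₀₁ = ∫ x in (0 : ℝ)..1, f x := by
  rw [integral_Icc_eq_integral_Ioc, intervalIntegral.integral_of_le zero_le_one]

theorem ae_uIoc_of_ae {P : ℝ → Prop} (h : ∀ᵐ x ∂μ₀₁, P x) :
    ∀ᵐ x ∂volume, x ∈ Set.uIoc (0 : ℝ) 1 → P x := by
  rw [Set.uIoc_of_le zero_le_one]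
  exact L2.ae_Ioc h 1

section WeightedForm

/-- The `L²` inner product with the weight `a + b x`. -/
noncomputable def weightedInner (a b : ℝ) (f g : L2) : ℝ :=
  ∫ x, (a + b * x) * (f x * g x) ∂μ₀₁

theorem integrable_weightedInner (a b : ℝ) (f g : L2) :
    Integrable (fun x => (a + b * x) * (f x * g x)) μ₀₁ := by
  have h1 : Integrable (fun x => f x * g x) μ₀₁ := by
    simpa [mul_comm] using L2.integrable_inner (𝕜 := ℝ) f g
  refine h1.bdd_mul (c := |a| + |b|) (by fun_prop) ?_
  filter_upwards [ae_restrict_mem measurableSet_Icc] with x hx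
  calc |a + b * x| ≤ |a| + |b| * |x| := (abs_add_le _ _).trans (by rw [abs_mul])
    _ ≤ |a| + |b| := by
      have : |x| ≤ 1 := abs_le.2 ⟨by linarith [hx.1], hx.2⟩
      have := mul_le_of_le_one_right (abs_nonneg b) this
      linarith

theorem weightedInner_comm (a b : ℝ) (f g : L2) :
    weightedInner a b f g = weightedInner a b g f := by
  simp only [weightedInner, mul_comm (f _)]

theorem weightedInner_add_left (a b : ℝ) (f f' g : L2) :
    weightedInner a b (f + f') g = weightedInner a b f g + weightedInner a b f' g := by
  unfold weightedInner
  rw [← integral_add (integrable_weightedInner a b f g) (integrable_weightedInner a b f' g)]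
  refine integral_congr_ae ?_
  filter_upwards [Lp.coeFn_add f f'] with x hx
  rw [hx, Pi.add_apply]
  ring

theorem weightedInner_smul_left (a b r : ℝ) (f g : L2) :
    weightedInner a b (r • f) g = r * weightedInner a b f g := by
  unfold weightedInner
  rw [← integral_const_mul]
  refine integral_congr_ae ?_
  filter_upwards [Lp.coeFn_smul r f] with x hx
  rw [hx, Pi.smul_apply, smul_eq_mul]
  ring

theorem weightedInner_smul_right (a b r : ℝ) (f g : L2) :
    weightedInner a b f (r • g) = r * weightedInner a b f g := by
  rw [weightedInner_comm, weightedInner_smul_left, weightedInner_comm]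

theorem norm_sq_eq_integral (f : L2) : ‖f‖ ^ 2 = ∫ x, f x * f x ∂μ₀₁ := by
  rw [← real_inner_self_eq_norm_sq, L2.inner_def]
  rfl

theorem integrable_mul_self (f : L2) : Integrable (fun x => f x * f x) μ₀₁ := by
  simpa using integrable_weightedInner 1 0 f f

theorem mul_norm_sq_le_weightedInner {a b l : ℝ} (h0 : l ≤ a) (h1 : l ≤ a + b) (f : L2) :
    l * ‖f‖ ^ 2 ≤ weightedInner a b f f := by
  rw [norm_sq_eq_integral, ← integral_const_mul]
  refine integral_mono_ae ((integrable_mul_self f).const_mul l)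
    (integrable_weightedInner a b f f) ?_
  filter_upwards [ae_restrict_mem measurableSet_Icc] with x hx
  refine mul_le_mul_of_nonneg_right ?_ (mul_self_nonneg _)
  nlinarith [hx.1, hx.2]

theorem weightedInner_le_mul_norm_sq {a b l : ℝ} (h0 : a ≤ l) (h1 : a + b ≤ l) (f : L2) :
    weightedInner a b f f ≤ l * ‖f‖ ^ 2 := by
  rw [norm_sq_eq_integral, ← integral_const_mul]
  refine integral_mono_ae (integrable_weightedInner a b f f)
    ((integrable_mul_self f).const_mul l) ?_
  filter_upwards [ae_restrict_mem measurableSet_Icc] with x hx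
  refine mul_le_mul_of_nonneg_right ?_ (mul_self_nonneg _)
  nlinarith [hx.1, hx.2]

end WeightedForm

/-! ### Calculus in `H¹` -/

namespace H1

theorem ext' {f k : H1} (h : f.fn = k.fn) (h' : f.deriv = k.deriv) : f = k :=
  Subtype.ext (Prod.ext h h')

theorem fn_add (f k : H1) : (f + k).fn = f.fn + k.fn := rfl
theorem fn_smul (a : ℝ) (f : H1) : (a • f).fn = a • f.fn := rfl
theorem deriv_add (f k : H1) : (f + k).deriv = f.deriv + k.deriv := rfl
theorem deriv_smul (a : ℝ) (f : H1) : (a • f).deriv = a • f.deriv := rfl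
theorem deriv_zero : (0 : H1).deriv = 0 := rfl

theorem fn_eq (f : H1) (x : unitInterval) : f.fn x = f.fn 0 + ∫ y in (0 : ℝ)..x, f.deriv y :=
  f.2 x

theorem _root_.WaveLoop.L2.intervalIntegrable_unit (w : L2) :
    IntervalIntegrable (fun y => w y) volume (0 : ℝ) 1 := w.intervalIntegrable 1

/-- The primitive of `w ∈ L²` with the value `a` at `0`. -/
noncomputable def primitive (a : ℝ) (w : L2) : H1 :=
  ⟨(⟨fun x => a + ∫ y in (0 : ℝ)..x, w y, by
      have h := intervalIntegral.continuousOn_primitive_interval'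
        w.intervalIntegrable_unit Set.left_mem_uIcc
      rw [Set.uIcc_of_le zero_le_one] at h
      exact continuous_const.add (h.comp_continuous continuous_subtype_val fun x => x.2)⟩, w),
    fun x => by simp⟩

theorem primitive_fn (a : ℝ) (w : L2) (x : unitInterval) :
    (primitive a w).fn x = a + ∫ y in (0 : ℝ)..x, w y := rfl

theorem primitive_fn_zero (a : ℝ) (w : L2) : (primitive a w).fn 0 = a := by
  simp [primitive_fn]

theorem primitive_deriv (a : ℝ) (w : L2) : (primitive a w).deriv = w := rfl

theorem exists_represents (f : H1) : ∃ w : L2, f.Represents w := by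
  have h : MemLp (Set.IccExtend (zero_le_one (α := ℝ)) f.fn) 2 μ₀₁ := by
    refine MemLp.of_bound (Continuous.aestronglyMeasurable ?_) ‖f.fn‖ (.of_forall fun x => ?_)
    · exact f.fn.continuous.Icc_extend'
    · exact f.fn.norm_coe_le_norm _
  exact ⟨h.toLp, h.coeFn_toLp⟩

theorem Represents.add {f k : H1} {w v : L2} (hf : f.Represents w) (hk : k.Represents v) :
    (f + k).Represents (w + v) := by
  filter_upwards [hf, hk, Lp.coeFn_add w v] with x h1 h2 h3
  rw [h3, Pi.add_apply, h1, h2]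
  rfl

theorem Represents.smul {f : H1} {w : L2} (a : ℝ) (hf : f.Represents w) :
    (a • f).Represents (a • w) := by
  filter_upwards [hf, Lp.coeFn_smul a w] with x h1 h2
  rw [h2, Pi.smul_apply, h1]
  rfl

theorem Represents.sub {f k : H1} {w v : L2} (hf : f.Represents w) (hk : k.Represents v) :
    (f - k).Represents (w - v) := by
  have := hf.add (hk.smul (-1))
  rwa [neg_one_smul, neg_one_smul, ← sub_eq_add_neg, ← sub_eq_add_neg] at this

/-- The extension of `f` to the line by the integral of its derivative. -/
noncomputable def line (f : H1) (x : ℝ) : ℝ := f.fn 0 + ∫ y in (0 : ℝ)..x, f.deriv y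

theorem line_eq (f : H1) (x : unitInterval) : f.line x = f.fn x := (f.fn_eq x).symm

theorem line_zero (f : H1) : f.line 0 = f.fn 0 := f.line_eq 0

theorem line_one (f : H1) : f.line 1 = f.fn 1 := f.line_eq 1

theorem Represents.line {f : H1} {w : L2} (hf : f.Represents w) : ∀ᵐ x ∂μ₀₁, w x = f.line x := by
  filter_upwards [hf, ae_restrict_mem measurableSet_Icc] with x h1 h2
  rw [h1, Set.IccExtend_of_mem _ _ h2]
  exact (f.line_eq ⟨x, h2⟩).symm

theorem absolutelyContinuous_line (f : H1) : AbsolutelyContinuousOnInterval f.line 0 1 := by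
  have h1 := f.deriv.intervalIntegrable_unit.absolutelyContinuousOnInterval_intervalIntegral
    (c := 0) Set.left_mem_uIcc
  have h2 : AbsolutelyContinuousOnInterval (fun _ : ℝ => f.fn 0) 0 1 :=
    (contDiff_const.contDiffOn (n := 1)).absolutelyContinuousOnInterval
  exact h2.add h1

theorem hasDerivAt_line (f : H1) : ∀ᵐ x, x ∈ Set.uIoc (0 : ℝ) 1 →
    HasDerivAt f.line (f.deriv x) x := by
  filter_upwards [f.deriv.intervalIntegrable_unit.ae_hasDerivAt_integral] with x h hx
  exact (h (Set.uIoc_subset_uIcc hx) 0 Set.left_mem_uIcc).const_add _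

/-- Integration by parts with an affine weight. -/
theorem weightedInner_deriv {f : H1} {w : L2} (hf : f.Represents w) (a b : ℝ) :
    2 * weightedInner a b w f.deriv = (a + b) * f.fn 1 ^ 2 - a * f.fn 0 ^ 2 - b * ‖w‖ ^ 2 := by
  have hm : AbsolutelyContinuousOnInterval (fun x : ℝ => a + b * x) 0 1 := by
    apply ContDiffOn.absolutelyContinuousOnInterval
    fun_prop
  have hF := f.absolutelyContinuous_line
  -- The product rule is applied to the factors `(a + b x) f` and `f`, both absolutely continuous.
  have key := (hm.fun_mul hF).integral_deriv_mul_eq_sub hF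
  rw [f.line_zero, f.line_one] at key
  have e : ∫ x in (0 : ℝ)..1, (_root_.deriv (fun x => (a + b * x) * f.line x) x * f.line x
      + (a + b * x) * f.line x * _root_.deriv f.line x)
      = ∫ x in (0 : ℝ)..1, (b * (w x * w x) + 2 * ((a + b * x) * (w x * f.deriv x))) := by
    apply intervalIntegral.integral_congr_ae
    filter_upwards [f.hasDerivAt_line, ae_uIoc_of_ae hf.line] with x h1 h2 hx
    have h3 : HasDerivAt (fun x : ℝ => a + b * x) b x := by
      simpa using ((hasDerivAt_id x).const_mul b).const_add a
    rw [(h1 hx).deriv, (h3.fun_mul (h1 hx)).deriv, h2 hx]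
    ring
  rw [e, ← integral_unitInterval, integral_add ((integrable_mul_self w).const_mul b)
    ((integrable_weightedInner a b w f.deriv).const_mul 2), integral_const_mul,
    integral_const_mul, ← norm_sq_eq_integral] at key
  unfold weightedInner
  linear_combination key

/-- Continuity upgrades almost everywhere vanishing to vanishing on `[0,1]`. The derivative
component then vanishes as well, because it is almost everywhere the classical derivative at
interior points. -/
theorem Represents.eq_zero {f : H1} (hf : f.Represents 0) : f = 0 := by
  have h0 : f.fn = 0 := by
    have h1 : (fun x => f.line x) =ᵐ[volume.restrict (Set.Icc (0 : ℝ) 1)] fun _ => (0 : ℝ) := by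
      filter_upwards [hf.line, Lp.coeFn_zero ℝ 2 μ₀₁] with x h2 h3
      rw [← h2, h3, Pi.zero_apply]
    have h2 := Measure.eqOn_Icc_of_ae_eq volume zero_ne_one h1
      (by simpa [Set.uIcc_of_le] using f.absolutelyContinuous_line.continuousOn)
      continuousOn_const
    ext x
    rw [← f.line_eq]
    exact h2 x.2
  refine ext' h0 ?_
  have h1 : ∀ x ∈ Set.Icc (0 : ℝ) 1, f.line x = 0 := fun x hx => by
    rw [show f.line x = f.fn ⟨x, hx⟩ from f.line_eq ⟨x, hx⟩, h0]
    rfl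
  rw [deriv_zero]
  refine Lp.ext ?_
  have h2 : ∀ᵐ x ∂μ₀₁, x ∈ Set.Ioo (0 : ℝ) 1 := by
    rw [Measure.restrict_congr_set Ioo_ae_eq_Icc.symm]
    exact ae_restrict_mem measurableSet_Ioo
  filter_upwards [ae_restrict_of_ae f.hasDerivAt_line, h2, Lp.coeFn_zero ℝ 2 μ₀₁] with x h3 h4 h5
  rw [h5, Pi.zero_apply]
  have h6 := h3 (by rw [Set.uIoc_of_le zero_le_one]; exact ⟨h4.1, h4.2.le⟩)
  refine h6.unique ((hasDerivAt_const x (0 : ℝ)).congr_of_eventuallyEq ?_)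
  filter_upwards [Ioo_mem_nhds h4.1 h4.2] with y hy
  exact h1 y ⟨hy.1.le, hy.2.le⟩

theorem abs_fn_sub_le (f : H1) (x y : unitInterval) : |f.fn x - f.fn y| ≤ ‖f.deriv‖ := by
  have h1 : f.fn x - f.fn y = ∫ s in (y : ℝ)..x, f.deriv s := by
    rw [f.fn_eq x, f.fn_eq y, ← intervalIntegral.integral_interval_sub_left
      (f.deriv.intervalIntegrable x) (f.deriv.intervalIntegrable y)]
    ring
  have hi : Integrable (fun s => f.deriv s) μ₀₁ := (Lp.memLp f.deriv).integrable (by norm_num)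
  have h2 : |f.fn x - f.fn y| ≤ ∫ s, |f.deriv s| ∂μ₀₁ := by
    rw [h1]
    refine (intervalIntegral.norm_integral_le_integral_norm_uIoc
      (f := fun s => f.deriv s)).trans ?_
    refine setIntegral_mono_set hi.norm (.of_forall fun s => norm_nonneg _) ?_
    exact LE.le.eventuallyLE (Set.uIoc_subset_uIcc.trans (Set.uIcc_subset_Icc y.2 x.2))
  refine h2.trans ((pow_le_pow_iff_left₀ (integral_nonneg fun _ => abs_nonneg _)
    (norm_nonneg _) two_ne_zero).1 ?_)
  set I := ∫ s, |f.deriv s| ∂μ₀₁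
  -- Integrating `(|f'| - I)² ≥ 0` gives `2I² ≤ ‖f'‖² + I²`, that is, the `L¹` norm `I` is at most
  -- the `L²` norm.
  have h3 : ∫ s, 2 * I * |f.deriv s| ∂μ₀₁ ≤ ∫ s, (f.deriv s * f.deriv s + I ^ 2) ∂μ₀₁ :=
    integral_mono (hi.norm.const_mul _) ((integrable_mul_self f.deriv).add (integrable_const _))
      fun s => by
        have := sq_nonneg (|f.deriv s| - I)
        rw [sub_sq, sq_abs] at this
        linarith [sq (f.deriv s)]
  rw [integral_const_mul, integral_add (integrable_mul_self f.deriv) (integrable_const _),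
    ← norm_sq_eq_integral, integral_const, measureReal_restrict_apply_univ,
    Real.volume_real_Icc] at h3
  norm_num at h3
  linarith [sq I]

theorem norm_eq (f : H1) : ‖f‖ = max ‖f.fn‖ ‖f.deriv‖ := rfl

theorem norm_fn_le (f : H1) (x : unitInterval) : ‖f.fn‖ ≤ |f.fn x| + ‖f.deriv‖ := by
  rw [ContinuousMap.norm_le _ (by positivity)]
  intro y
  have := f.abs_fn_sub_le y x
  calc |f.fn y| = |f.fn x + (f.fn y - f.fn x)| := by ring_nf
    _ ≤ _ := (abs_add_le _ _).trans (by linarith)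

end H1

/-! ### The state space and the closed-loop operator -/

namespace StateSpace

theorem fn_one_eq (z : StateSpace) : z.u.fn 1 = z.v.fn 0 := z.2

theorem ext' {z w : StateSpace} (h₁ : z.u = w.u) (h₂ : z.ut = w.ut) (h₃ : z.v = w.v)
    (h₄ : z.vt = w.vt) : z = w :=
  Subtype.ext (Prod.ext h₁ (Prod.ext h₂ (Prod.ext h₃ h₄)))

theorem u_add (z w : StateSpace) : (z + w).u = z.u + w.u := rfl
theorem ut_add (z w : StateSpace) : (z + w).ut = z.ut + w.ut := rfl
theorem v_add (z w : StateSpace) : (z + w).v = z.v + w.v := rfl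
theorem vt_add (z w : StateSpace) : (z + w).vt = z.vt + w.vt := rfl
theorem u_smul (a : ℝ) (z : StateSpace) : (a • z).u = a • z.u := rfl
theorem ut_smul (a : ℝ) (z : StateSpace) : (a • z).ut = a • z.ut := rfl
theorem v_smul (a : ℝ) (z : StateSpace) : (a • z).v = a • z.v := rfl
theorem vt_smul (a : ℝ) (z : StateSpace) : (a • z).vt = a • z.vt := rfl

end StateSpace

section Graph

variable {c₁ c₂ g h q : ℝ}

theorem ClosedLoopGraph.add {z w z' w' : StateSpace} (H : ClosedLoopGraph c₁ c₂ g h q z w)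
    (H' : ClosedLoopGraph c₁ c₂ g h q z' w') :
    ClosedLoopGraph c₁ c₂ g h q (z + z') (w + w') := by
  obtain ⟨hu, hv, ux, vx, hux, hvx, hut, hvt, b₀, b₁, b₂⟩ := H
  obtain ⟨hu', hv', ux', vx', hux', hvx', hut', hvt', b₀', b₁', b₂'⟩ := H'
  refine ⟨hu.add hu', hv.add hv', ux + ux', vx + vx', hux.add hux', hvx.add hvx', ?_, ?_, ?_, ?_, ?_⟩
  · rw [StateSpace.ut_add, hut, hut', H1.deriv_add, smul_add]
  · rw [StateSpace.vt_add, hvt, hvt', H1.deriv_add, smul_add]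
  · simp only [StateSpace.u_add, H1.fn_add, ContinuousMap.add_apply, b₀, b₀']
    ring
  · simp only [H1.fn_add, ContinuousMap.add_apply, b₁, b₁']
  · simp only [StateSpace.v_add, H1.fn_add, ContinuousMap.add_apply, b₂, b₂']
    ring

theorem ClosedLoopGraph.smul {z w : StateSpace} (a : ℝ) (H : ClosedLoopGraph c₁ c₂ g h q z w) :
    ClosedLoopGraph c₁ c₂ g h q (a • z) (a • w) := by
  obtain ⟨hu, hv, ux, vx, hux, hvx, hut, hvt, b₀, b₁, b₂⟩ := H
  refine ⟨hu.smul a, hv.smul a, a • ux, a • vx, hux.smul a, hvx.smul a, ?_, ?_, ?_, ?_, ?_⟩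
  · rw [StateSpace.ut_smul, hut, H1.deriv_smul, smul_comm]
  · rw [StateSpace.vt_smul, hvt, H1.deriv_smul, smul_comm]
  · simp only [StateSpace.u_smul, H1.fn_smul, ContinuousMap.smul_apply, smul_eq_mul, b₀]
    ring
  · simp only [H1.fn_smul, ContinuousMap.smul_apply, b₁]
  · simp only [StateSpace.v_smul, H1.fn_smul, ContinuousMap.smul_apply, smul_eq_mul, b₂]
    ring

theorem ClosedLoopGraph.sub {z w z' w' : StateSpace} (H : ClosedLoopGraph c₁ c₂ g h q z w)
    (H' : ClosedLoopGraph c₁ c₂ g h q z' w') :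
    ClosedLoopGraph c₁ c₂ g h q (z - z') (w - w') := by
  have := H.add (H'.smul (-1))
  rwa [neg_one_smul, neg_one_smul, ← sub_eq_add_neg, ← sub_eq_add_neg] at this

/-- The operator of the closed loop is single-valued. -/
theorem ClosedLoopGraph.eq_zero {w : StateSpace} (H : ClosedLoopGraph c₁ c₂ g h q 0 w) :
    w = 0 := by
  obtain ⟨hu, hv, ux, vx, hux, hvx, hut, hvt, -⟩ := H
  have e₁ : ux = 0 := H1.Represents.eq_zero hux
  have e₂ : vx = 0 := H1.Represents.eq_zero hvx
  rw [e₁, H1.deriv_zero, smul_zero] at hut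
  rw [e₂, H1.deriv_zero, smul_zero] at hvt
  exact StateSpace.ext' (H1.Represents.eq_zero hu) hut (H1.Represents.eq_zero hv) hvt

/-- The operator of the closed loop is onto. -/
theorem exists_closedLoopGraph (hc₁ : c₁ ≠ 0) (hc₂ : c₂ ≠ 0) (hq : q ≠ 0) (w : StateSpace) :
    ∃ z, ClosedLoopGraph c₁ c₂ g h q z w := by
  obtain ⟨p, hp⟩ := w.u.exists_represents
  obtain ⟨r, hr⟩ := w.v.exists_represents
  set ux := H1.primitive (g * w.u.fn 0) ((c₁ ^ 2)⁻¹ • w.ut)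
  set vx := H1.primitive (ux.fn 1) ((c₂ ^ 2)⁻¹ • w.vt)
  obtain ⟨du, hdu⟩ := ux.exists_represents
  obtain ⟨dv, hdv⟩ := vx.exists_represents
  -- The slopes are already fixed by the conditions at `0` and at the junction. The remaining
  -- boundary condition prescribes `v(1)`, through division by `q`; the constant of `u` is then set
  -- by `u(1) = v(0)`.
  set v := H1.primitive ((-h * w.v.fn 1 - vx.fn 1) / q - ∫ y in (0 : ℝ)..1, dv y) dv
  set u := H1.primitive (v.fn 0 - ∫ y in (0 : ℝ)..1, du y) du
  have huv : u.fn 1 = v.fn 0 := by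
    rw [H1.primitive_fn]
    simp
  have hv1 : v.fn 1 = (-h * w.v.fn 1 - vx.fn 1) / q := by
    rw [H1.primitive_fn]
    simp
  refine ⟨⟨(u, p, v, r), huv⟩, hp, hr, ux, vx, hdu, hdv, ?_, ?_, ?_, ?_, ?_⟩
  · rw [H1.primitive_deriv, smul_inv_smul₀ (pow_ne_zero 2 hc₁)]
  · rw [H1.primitive_deriv, smul_inv_smul₀ (pow_ne_zero 2 hc₂)]
  · exact H1.primitive_fn_zero _ _
  · exact H1.primitive_fn_zero _ _
  · change vx.fn 1 = -h * w.v.fn 1 - q * v.fn 1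
    rw [hv1]
    field_simp
    ring

end Graph

/-! ### Equivalence of the two norms -/

section Norms

variable (c₁ c₂ : ℝ)

theorem normH0_sq (z : StateSpace) : z.normH0 c₁ c₂ ^ 2 = c₁ ^ 2 * ‖z.u.deriv‖ ^ 2 + ‖z.ut‖ ^ 2
    + c₂ ^ 2 * ‖z.v.deriv‖ ^ 2 + ‖z.vt‖ ^ 2 + z.v.fn 1 ^ 2 :=
  Real.sq_sqrt (by positivity)

theorem normH0_nonneg (z : StateSpace) : 0 ≤ z.normH0 c₁ c₂ := Real.sqrt_nonneg _

theorem StateSpace.norm_eq (z : StateSpace) :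
    ‖z‖ = max ‖z.u‖ (max ‖z.ut‖ (max ‖z.v‖ ‖z.vt‖)) := rfl

theorem normH0_sq_le (z : StateSpace) :
    z.normH0 c₁ c₂ ^ 2 ≤ (c₁ ^ 2 + 1 + c₂ ^ 2 + 1 + 1) * ‖z‖ ^ 2 := by
  have h₁ : ‖z.u‖ ≤ ‖z‖ := le_max_left _ _
  have h₂ : ‖z.ut‖ ≤ ‖z‖ := (le_max_left _ _).trans (le_max_right _ _)
  have h₃ : ‖z.v‖ ≤ ‖z‖ := (le_max_left _ _).trans ((le_max_right _ _).trans (le_max_right _ _))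
  have h₄ : ‖z.vt‖ ≤ ‖z‖ := (le_max_right _ _).trans ((le_max_right _ _).trans (le_max_right _ _))
  have h₅ : ‖z.u.deriv‖ ≤ ‖z‖ := (le_max_right _ _ : _ ≤ ‖z.u‖).trans h₁
  have h₆ : ‖z.v.deriv‖ ≤ ‖z‖ := (le_max_right _ _ : _ ≤ ‖z.v‖).trans h₃
  have h₇ : |z.v.fn 1| ≤ ‖z‖ :=
    (z.v.fn.norm_coe_le_norm 1).trans ((le_max_left _ _ : _ ≤ ‖z.v‖).trans h₃)
  rw [normH0_sq, ← sq_abs (z.v.fn 1)]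
  simp only [add_mul, one_mul]
  gcongr

variable {c₁ c₂}

/-- The value `v(1)` and the derivative control `v` uniformly, hence `v(0) = u(1)`, and this value
with the derivative controls `u`. -/
theorem norm_le_normH0 (hc₁ : 0 < c₁) (hc₂ : 0 < c₂) (z : StateSpace) :
    ‖z‖ ≤ (1 + c₁⁻¹ + c₂⁻¹) * z.normH0 c₁ c₂ := by
  have hN := normH0_sq c₁ c₂ z
  have hN0 := normH0_nonneg c₁ c₂ z
  set N := z.normH0 c₁ c₂
  have p₁ : 0 ≤ c₁ ^ 2 * ‖z.u.deriv‖ ^ 2 := by positivity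
  have p₂ : 0 ≤ c₂ ^ 2 * ‖z.v.deriv‖ ^ 2 := by positivity
  have h₁ : ‖z.u.deriv‖ ≤ c₁⁻¹ * N := by
    rw [inv_mul_eq_div, le_div_iff₀' hc₁]
    refine (pow_le_pow_iff_left₀ (by positivity) hN0 two_ne_zero).1 ?_
    rw [mul_pow, hN]
    linarith [sq_nonneg ‖z.ut‖, sq_nonneg ‖z.vt‖, sq_nonneg (z.v.fn 1)]
  have h₂ : ‖z.v.deriv‖ ≤ c₂⁻¹ * N := by
    rw [inv_mul_eq_div, le_div_iff₀' hc₂]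
    refine (pow_le_pow_iff_left₀ (by positivity) hN0 two_ne_zero).1 ?_
    rw [mul_pow, hN]
    linarith [sq_nonneg ‖z.ut‖, sq_nonneg ‖z.vt‖, sq_nonneg (z.v.fn 1)]
  have h₃ : ‖z.ut‖ ≤ N := by
    refine (pow_le_pow_iff_left₀ (by positivity) hN0 two_ne_zero).1 ?_
    linarith [sq_nonneg ‖z.vt‖, sq_nonneg (z.v.fn 1)]
  have h₄ : ‖z.vt‖ ≤ N := by
    refine (pow_le_pow_iff_left₀ (by positivity) hN0 two_ne_zero).1 ?_
    linarith [sq_nonneg ‖z.ut‖, sq_nonneg (z.v.fn 1)]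
  have h₅ : |z.v.fn 1| ≤ N := by
    refine (pow_le_pow_iff_left₀ (by positivity) hN0 two_ne_zero).1 ?_
    rw [sq_abs]
    linarith [sq_nonneg ‖z.ut‖, sq_nonneg ‖z.vt‖]
  have q₁ : 0 ≤ c₁⁻¹ * N := by positivity
  have q₂ : 0 ≤ c₂⁻¹ * N := by positivity
  have h₆ := z.v.norm_fn_le 1
  have h₇ := z.u.norm_fn_le 1
  have h₈ : |z.u.fn 1| ≤ ‖z.v.fn‖ := by
    rw [z.fn_one_eq]
    exact z.v.fn.norm_coe_le_norm 0
  rw [z.norm_eq, H1.norm_eq, H1.norm_eq]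
  simp only [max_le_iff]
  refine ⟨⟨?_, ?_⟩, ?_, ⟨?_, ?_⟩, ?_⟩ <;> linarith

end Norms

/-! ### The quadratic form of the matrix inequality -/

/-- A positive definite quadratic form is bounded below by a multiple of the sum of squares. -/
theorem exists_mul_sum_sq_le_of_posDef {n : Type*} [Fintype n] {M : Matrix n n ℝ}
    (hM : M.PosDef) : ∃ δ : ℝ, 0 < δ ∧ ∀ y : n → ℝ, δ * ∑ i, y i ^ 2 ≤ y ⬝ᵥ (M.mulVec y) := by
  have hcont : Continuous fun y : EuclideanSpace ℝ n => y.ofLp ⬝ᵥ (M.mulVec y.ofLp) := by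
    simp only [dotProduct, Matrix.mulVec]
    fun_prop
  have hpos : ∀ y : n → ℝ, y ≠ 0 → 0 < y ⬝ᵥ (M.mulVec y) := fun y hy => by
    simpa using hM.dotProduct_mulVec_pos hy
  rcases isEmpty_or_nonempty n with hn | hn
  · exact ⟨1, one_pos, fun y => by simp⟩
  obtain ⟨y₀, hy₀, hmin⟩ := (isCompact_sphere (0 : EuclideanSpace ℝ n) 1).exists_isMinOn
    (NormedSpace.sphere_nonempty.2 zero_le_one) hcont.continuousOn
  -- The constant is the minimum of the form on the Euclidean unit sphere; other vectors follow by
  -- scaling.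
  refine ⟨_, hpos y₀.ofLp fun h => ?_, fun y => ?_⟩
  · have h1 : y₀ = 0 := by
      ext i
      exact congrFun h i
    simp [h1] at hy₀
  · set Y : EuclideanSpace ℝ n := WithLp.toLp 2 y
    have hY : ∑ i, y i ^ 2 = ‖Y‖ ^ 2 := by simp [EuclideanSpace.norm_sq_eq, Y]
    rw [hY]
    rcases (norm_nonneg Y).eq_or_lt with h0 | h0
    · have h1 : y = 0 := by
        have := norm_eq_zero.1 h0.symm
        ext i
        exact congrArg (fun Z : EuclideanSpace ℝ n => Z i) this
      rw [← h0, h1]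
      simp
    · have h1 := hmin (show ‖Y‖⁻¹ • Y ∈ Metric.sphere (0 : EuclideanSpace ℝ n) 1 by
        simp [norm_smul, h0.ne'])
      simp only [Set.mem_ofPred_eq, WithLp.ofLp_smul, Matrix.mulVec_smul, smul_dotProduct,
        dotProduct_smul, smul_eq_mul] at h1
      calc _ ≤ (‖Y‖⁻¹ * (‖Y‖⁻¹ * (Y.ofLp ⬝ᵥ M.mulVec Y.ofLp))) * ‖Y‖ ^ 2 :=
            mul_le_mul_of_nonneg_right h1 (sq_nonneg _)
        _ = y ⬝ᵥ M.mulVec y := by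
            field_simp
            rfl

theorem sum_sq_mulVec {m n : Type*} [Fintype m] [Fintype n] [DecidableEq m] (A : Matrix m n ℝ)
    (s : m → ℝ) (y : n → ℝ) :
    y ⬝ᵥ ((A.transpose * Matrix.diagonal s * A).mulVec y) = ∑ i, s i * (A.mulVec y i) ^ 2 := by
  rw [Matrix.mul_assoc, ← Matrix.mulVec_mulVec, ← Matrix.mulVec_mulVec, Matrix.dotProduct_mulVec,
    Matrix.vecMul_transpose]
  simp only [dotProduct, Matrix.mulVec_diagonal]
  exact Finset.sum_congr rfl fun i _ => by ring

/-- The quadratic form of `Ψ(0)`. -/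
theorem dotProduct_Psi_mulVec (c₁ c₂ h q k S₁ S₂ S₃ S₄ S₅ y₀ y₁ y₂ y₃ y₄ : ℝ) :
    ![y₀, y₁, y₂, y₃, y₄] ⬝ᵥ
        ((Psi c₁ c₂ h q k S₁ S₂ S₃ S₄ S₅ 0).mulVec ![y₀, y₁, y₂, y₃, y₄])
      = S₁ * ((y₂ + c₁ * y₁) ^ 2 - (y₀ + k * y₀) ^ 2)
        + S₂ * ((y₀ - k * y₀) ^ 2 - (y₂ - c₁ * y₁) ^ 2)
        + S₃ * ((y₃ + c₂ * (-h * y₃ - q * y₄)) ^ 2 - (y₂ + c₂ * y₁) ^ 2)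
        + S₄ * ((y₂ - c₂ * y₁) ^ 2 - (y₃ - c₂ * (-h * y₃ - q * y₄)) ^ 2)
        + 2 * S₅ * (y₄ * y₃) := by
  have hE : Emat c₁ c₂ 0 1 = 1 := by
    rw [Emat, ← Matrix.diagonal_one]
    congr 1
    ext i
    fin_cases i <;> simp
  rw [Psi, hE, Matrix.mul_one, Matrix.add_mulVec, Matrix.sub_mulVec, dotProduct_add,
    dotProduct_sub, sum_sq_mulVec, sum_sq_mulVec]
  simp [Fin.sum_univ_succ, Hmat, Gmat, Qmat, Matrix.mulVec, dotProduct]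
  ring

/-! ### Characteristic variables and the Lyapunov functional -/

namespace StateSpace

/-- The characteristic variable `uₜ + c uₓ` of the string. -/
noncomputable def charU (c : ℝ) (z : StateSpace) : L2 := z.ut + c • z.u.deriv

/-- The characteristic variable `vₜ + c vₓ` of the controller. -/
noncomputable def charV (c : ℝ) (z : StateSpace) : L2 := z.vt + c • z.v.deriv

theorem charU_add (c : ℝ) (z w : StateSpace) : (z + w).charU c = z.charU c + w.charU c := by
  simp only [charU, ut_add, u_add, H1.deriv_add, smul_add]
  abel

theorem charV_add (c : ℝ) (z w : StateSpace) : (z + w).charV c = z.charV c + w.charV c := by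
  simp only [charV, vt_add, v_add, H1.deriv_add, smul_add]
  abel

theorem charU_smul (c a : ℝ) (z : StateSpace) : (a • z).charU c = a • z.charU c := by
  simp only [charU, ut_smul, u_smul, H1.deriv_smul, smul_add, smul_comm c a]

theorem charV_smul (c a : ℝ) (z : StateSpace) : (a • z).charV c = a • z.charV c := by
  simp only [charV, vt_smul, v_smul, H1.deriv_smul, smul_add, smul_comm c a]

theorem norm_charU_sq_add (c : ℝ) (z : StateSpace) :
    ‖z.charU c‖ ^ 2 + ‖z.charU (-c)‖ ^ 2 = 2 * (c ^ 2 * ‖z.u.deriv‖ ^ 2 + ‖z.ut‖ ^ 2) := by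
  have := parallelogram_law_with_norm ℝ z.ut (c • z.u.deriv)
  rw [charU, charU, neg_smul, ← sub_eq_add_neg, this, norm_smul, ← sq_abs c,
    Real.norm_eq_abs]
  ring

theorem norm_charV_sq_add (c : ℝ) (z : StateSpace) :
    ‖z.charV c‖ ^ 2 + ‖z.charV (-c)‖ ^ 2 = 2 * (c ^ 2 * ‖z.v.deriv‖ ^ 2 + ‖z.vt‖ ^ 2) := by
  have := parallelogram_law_with_norm ℝ z.vt (c • z.v.deriv)
  rw [charV, charV, neg_smul, ← sub_eq_add_neg, this, norm_smul, ← sq_abs c,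
    Real.norm_eq_abs]
  ring

end StateSpace

/-- Each characteristic variable of `A z` is a multiple of the derivative of the one of `z`. -/
theorem weightedInner_char {p ux : H1} {p₀ d₀ p₁ d₁ : L2} {c : ℝ} (hp : p.Represents p₀)
    (hd : ux.Represents d₀) (hd₁ : d₁ = p.deriv) (hp₁ : p₁ = c ^ 2 • ux.deriv) (a b : ℝ) :
    2 * weightedInner a b (p₀ + c • d₀) (p₁ + c • d₁)
      = c * ((a + b) * (p.fn 1 + c * ux.fn 1) ^ 2 - a * (p.fn 0 + c * ux.fn 0) ^ 2
        - b * ‖p₀ + c • d₀‖ ^ 2) := by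
  have e : p₁ + c • d₁ = c • (p + c • ux).deriv := by
    rw [hp₁, hd₁, H1.deriv_add, H1.deriv_smul, smul_add, smul_smul, sq, add_comm]
  rw [e, weightedInner_smul_right, mul_left_comm, H1.weightedInner_deriv (hp.add (hd.smul c))]
  rfl

section Energy

/-- The Lyapunov functional of the closed loop, as a bilinear form. -/
noncomputable def energyForm (c₁ c₂ S₁ S₂ S₃ S₄ S₅ ε : ℝ) (z w : StateSpace) : ℝ :=
  S₁ / c₁ * weightedInner 1 ε (z.charU c₁) (w.charU c₁)
    + S₂ / c₁ * weightedInner (1 + ε) (-ε) (z.charU (-c₁)) (w.charU (-c₁))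
    + S₃ / c₂ * weightedInner 1 ε (z.charV c₂) (w.charV c₂)
    + S₄ / c₂ * weightedInner (1 + ε) (-ε) (z.charV (-c₂)) (w.charV (-c₂))
    + S₅ * (z.v.fn 1 * w.v.fn 1)

variable {c₁ c₂ S₁ S₂ S₃ S₄ S₅ ε : ℝ}

theorem energyForm_comm (z w : StateSpace) :
    energyForm c₁ c₂ S₁ S₂ S₃ S₄ S₅ ε z w = energyForm c₁ c₂ S₁ S₂ S₃ S₄ S₅ ε w z := by
  simp only [energyForm, weightedInner_comm _ _ (z.charU _), weightedInner_comm _ _ (z.charV _),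
    mul_comm (z.v.fn 1)]

theorem energyForm_add_left (z z' w : StateSpace) :
    energyForm c₁ c₂ S₁ S₂ S₃ S₄ S₅ ε (z + z') w = energyForm c₁ c₂ S₁ S₂ S₃ S₄ S₅ ε z w
      + energyForm c₁ c₂ S₁ S₂ S₃ S₄ S₅ ε z' w := by
  simp only [energyForm, StateSpace.charU_add, StateSpace.charV_add, weightedInner_add_left,
    StateSpace.v_add, H1.fn_add, ContinuousMap.add_apply]
  ring

theorem energyForm_smul_left (a : ℝ) (z w : StateSpace) :
    energyForm c₁ c₂ S₁ S₂ S₃ S₄ S₅ ε (a • z) w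
      = a * energyForm c₁ c₂ S₁ S₂ S₃ S₄ S₅ ε z w := by
  simp only [energyForm, StateSpace.charU_smul, StateSpace.charV_smul, weightedInner_smul_left,
    StateSpace.v_smul, H1.fn_smul, ContinuousMap.smul_apply, smul_eq_mul]
  ring

/-- Both weights stay at or above `1`, and by the parallelogram law the squared norms of a pair of
characteristic variables add up to twice the energy of that string. -/
theorem mul_normH0_sq_le_energyForm {m : ℝ} (hm : 0 ≤ m) (hε : 0 ≤ ε) (h₁ : m ≤ S₁ / c₁)
    (h₂ : m ≤ S₂ / c₁) (h₃ : m ≤ S₃ / c₂) (h₄ : m ≤ S₄ / c₂) (h₅ : m ≤ S₅) (z : StateSpace) :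
    m * z.normH0 c₁ c₂ ^ 2 ≤ energyForm c₁ c₂ S₁ S₂ S₃ S₄ S₅ ε z z := by
  have key : ∀ (a b s : ℝ) (f : L2), 1 ≤ a → 1 ≤ a + b → m ≤ s →
      m * ‖f‖ ^ 2 ≤ s * weightedInner a b f f := fun a b s f ha hab hs => by
    have := mul_norm_sq_le_weightedInner ha hab f
    rw [one_mul] at this
    exact mul_le_mul hs this (sq_nonneg _) (hm.trans hs)
  have k₁ := key 1 ε _ (z.charU c₁) le_rfl (by linarith) h₁
  have k₂ := key (1 + ε) (-ε) _ (z.charU (-c₁)) (by linarith) (by linarith) h₂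
  have k₃ := key 1 ε _ (z.charV c₂) le_rfl (by linarith) h₃
  have k₄ := key (1 + ε) (-ε) _ (z.charV (-c₂)) (by linarith) (by linarith) h₄
  have k₅ : m * z.v.fn 1 ^ 2 ≤ S₅ * (z.v.fn 1 * z.v.fn 1) := by
    rw [← sq]
    exact mul_le_mul_of_nonneg_right h₅ (sq_nonneg _)
  have e₁ := congrArg (m * ·) (z.norm_charU_sq_add c₁)
  have e₂ := congrArg (m * ·) (z.norm_charV_sq_add c₂)
  have p₁ : 0 ≤ m * (c₁ ^ 2 * ‖z.u.deriv‖ ^ 2 + ‖z.ut‖ ^ 2) := by positivity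
  have p₂ : 0 ≤ m * (c₂ ^ 2 * ‖z.v.deriv‖ ^ 2 + ‖z.vt‖ ^ 2) := by positivity
  rw [normH0_sq, energyForm]
  simp only [mul_add] at e₁ e₂ p₁ p₂ ⊢
  linarith

theorem energyForm_le_mul (hε1 : ε ≤ 1)
    (h₁ : 0 ≤ S₁ / c₁) (h₂ : 0 ≤ S₂ / c₁) (h₃ : 0 ≤ S₃ / c₂) (h₄ : 0 ≤ S₄ / c₂)
    (z : StateSpace) :
    energyForm c₁ c₂ S₁ S₂ S₃ S₄ S₅ ε z z ≤ 2 * (S₁ / c₁ * ‖z.charU c₁‖ ^ 2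
      + S₂ / c₁ * ‖z.charU (-c₁)‖ ^ 2 + S₃ / c₂ * ‖z.charV c₂‖ ^ 2
      + S₄ / c₂ * ‖z.charV (-c₂)‖ ^ 2) + S₅ * z.v.fn 1 ^ 2 := by
  have key : ∀ (a b s : ℝ) (f : L2), a ≤ 2 → a + b ≤ 2 → 0 ≤ s →
      s * weightedInner a b f f ≤ s * (2 * ‖f‖ ^ 2) := fun a b s f ha hab hs =>
    mul_le_mul_of_nonneg_left (weightedInner_le_mul_norm_sq ha hab f) hs
  have k₁ := key 1 ε _ (z.charU c₁) (by linarith) (by linarith) h₁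
  have k₂ := key (1 + ε) (-ε) _ (z.charU (-c₁)) (by linarith) (by linarith) h₂
  have k₃ := key 1 ε _ (z.charV c₂) (by linarith) (by linarith) h₃
  have k₄ := key (1 + ε) (-ε) _ (z.charV (-c₂)) (by linarith) (by linarith) h₄
  rw [energyForm, sq (z.v.fn 1)]
  linarith

theorem energyForm_le_mul_normH0_sq {M : ℝ} (hε1 : ε ≤ 1)
    (h₁ : 0 ≤ S₁ / c₁) (h₂ : 0 ≤ S₂ / c₁) (h₃ : 0 ≤ S₃ / c₂) (h₄ : 0 ≤ S₄ / c₂)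
    (h₁' : S₁ / c₁ ≤ M) (h₂' : S₂ / c₁ ≤ M) (h₃' : S₃ / c₂ ≤ M) (h₄' : S₄ / c₂ ≤ M)
    (h₅' : S₅ ≤ M) (z : StateSpace) :
    energyForm c₁ c₂ S₁ S₂ S₃ S₄ S₅ ε z z ≤ 4 * M * z.normH0 c₁ c₂ ^ 2 := by
  have k := energyForm_le_mul (S₅ := S₅) hε1 h₁ h₂ h₃ h₄ z
  have k₁ := mul_le_mul_of_nonneg_right h₁' (sq_nonneg ‖z.charU c₁‖)
  have k₂ := mul_le_mul_of_nonneg_right h₂' (sq_nonneg ‖z.charU (-c₁)‖)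
  have k₃ := mul_le_mul_of_nonneg_right h₃' (sq_nonneg ‖z.charV c₂‖)
  have k₄ := mul_le_mul_of_nonneg_right h₄' (sq_nonneg ‖z.charV (-c₂)‖)
  have k₅ := mul_le_mul_of_nonneg_right h₅' (sq_nonneg (z.v.fn 1))
  have e₁ := congrArg (M * ·) (z.norm_charU_sq_add c₁)
  have e₂ := congrArg (M * ·) (z.norm_charV_sq_add c₂)
  have p : 0 ≤ M * z.v.fn 1 ^ 2 := mul_nonneg (h₁.trans h₁') (sq_nonneg _)
  rw [normH0_sq]
  simp only [mul_add] at e₁ e₂ p ⊢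
  linarith

/-- The dissipation identity: `2 ⟨z, A z⟩` in terms of the boundary values. -/
theorem two_mul_energyForm_eq {g h q : ℝ} (hc₁ : c₁ ≠ 0) (hc₂ : c₂ ≠ 0) {z w : StateSpace}
    (H : ClosedLoopGraph c₁ c₂ g h q z w) : ∃ y₀ y₁ y₂ y₃ : ℝ,
    2 * energyForm c₁ c₂ S₁ S₂ S₃ S₄ S₅ ε z w
      = ![y₀, y₁, y₂, y₃, z.v.fn 1] ⬝ᵥ ((Psi c₁ c₂ h q (c₁ * g) S₁ S₂ S₃ S₄ S₅ 0).mulVec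
          ![y₀, y₁, y₂, y₃, z.v.fn 1])
        + ε * (S₁ * (y₂ + c₁ * y₁) ^ 2 + S₂ * (y₀ - c₁ * g * y₀) ^ 2
          + S₃ * (y₃ + c₂ * (-h * y₃ - q * z.v.fn 1)) ^ 2 + S₄ * (y₂ - c₂ * y₁) ^ 2)
        - ε * (S₁ * ‖z.charU c₁‖ ^ 2 + S₂ * ‖z.charU (-c₁)‖ ^ 2 + S₃ * ‖z.charV c₂‖ ^ 2
          + S₄ * ‖z.charV (-c₂)‖ ^ 2) := by
  obtain ⟨hu, hv, ux, vx, hux, hvx, hut, hvt, b₀, b₁, b₂⟩ := H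
  -- For `w = A z` these are `p(0)`, `uₓ(1)`, `p(1) = r(0)` and `r(1)`. With `v(1)`, they determine
  -- all boundary values of the characteristic variables.
  refine ⟨w.u.fn 0, ux.fn 1, w.u.fn 1, w.v.fn 1, ?_⟩
  have k₁ := weightedInner_char hu hux rfl hut 1 ε
  have k₂ := weightedInner_char (p₁ := w.ut) (c := -c₁) hu hux rfl (by rw [neg_sq, hut]) (1 + ε) (-ε)
  have k₃ := weightedInner_char hv hvx rfl hvt 1 ε
  have k₄ := weightedInner_char (p₁ := w.vt) (c := -c₂) hv hvx rfl (by rw [neg_sq, hvt]) (1 + ε) (-ε)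
  rw [b₀] at k₁ k₂
  rw [b₁, b₂, ← w.fn_one_eq] at k₃ k₄
  rw [dotProduct_Psi_mulVec]
  simp only [energyForm, mul_add, mul_left_comm (2 : ℝ) (_ / _)]
  simp only [StateSpace.charU, StateSpace.charV]
  rw [k₁, k₂, k₃, k₄]
  field_simp
  ring

end Energy

theorem sq_add_le_mul (a b x y : ℝ) : (a * x + b * y) ^ 2 ≤ (a ^ 2 + b ^ 2) * (x ^ 2 + y ^ 2) := by
  nlinarith [sq_nonneg (a * y - b * x)]

/-- The matrix inequality makes the operator of the closed loop dissipative for the energy form. -/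
theorem exists_energyForm_le {c₁ c₂ g h q S₁ S₂ S₃ S₄ S₅ : ℝ} (hc₁ : 0 < c₁) (hc₂ : 0 < c₂)
    (h₁ : 0 < S₁) (h₂ : 0 < S₂) (h₃ : 0 < S₃) (h₄ : 0 < S₄) (h₅ : 0 < S₅)
    (hΨ : (-Psi c₁ c₂ h q (c₁ * g) S₁ S₂ S₃ S₄ S₅ 0).PosDef) :
    ∃ ε α : ℝ, 0 ≤ ε ∧ ε ≤ 1 ∧ 0 < α ∧ ∀ z w, ClosedLoopGraph c₁ c₂ g h q z w →
      energyForm c₁ c₂ S₁ S₂ S₃ S₄ S₅ ε z w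
        ≤ -α * energyForm c₁ c₂ S₁ S₂ S₃ S₄ S₅ ε z z := by
  obtain ⟨δ, hδ, hδΨ⟩ := exists_mul_sum_sq_le_of_posDef hΨ
  -- `K` bounds the weighted squares of the inflow values by the sum of squares of the boundary
  -- vector. The choice of `ε` below makes `ε K ≤ δ / 2`, which spends half of the definiteness
  -- margin `δ`.
  set K := S₁ * (1 ^ 2 + c₁ ^ 2) + S₂ * (1 - c₁ * g) ^ 2
    + S₃ * ((1 - c₂ * h) ^ 2 + (-(c₂ * q)) ^ 2) + S₄ * (1 ^ 2 + (-c₂) ^ 2) with hK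
  have hK0 : 0 ≤ K := by positivity
  set ε := min 1 (δ / (2 * (K + 1)))
  have hε : 0 < ε := lt_min one_pos (by positivity)
  have hεK : ε * K ≤ δ / 2 := by
    have : ε ≤ δ / (2 * (K + 1)) := min_le_right _ _
    rw [le_div_iff₀ (by positivity)] at this
    nlinarith
  -- By `energyForm_le_mul`, twice `α` times the energy is at most `4α` times the terms `(S/c)‖·‖²`
  -- plus `2α S₅ v(1)²`. The first two bounds let the interior loss pay for the former, the last
  -- lets the other half of `δ` pay for the latter.
  set α := min (ε * c₁ / 4) (min (ε * c₂ / 4) (δ / (4 * S₅)))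
  have hα : 0 < α := lt_min (by positivity) (lt_min (by positivity) (by positivity))
  have hα₁ : 4 * α / c₁ ≤ ε := by
    rw [div_le_iff₀ hc₁]
    linarith [show α ≤ ε * c₁ / 4 from min_le_left _ _]
  have hα₂ : 4 * α / c₂ ≤ ε := by
    rw [div_le_iff₀ hc₂]
    linarith [show α ≤ ε * c₂ / 4 from (min_le_right _ _).trans (min_le_left _ _)]
  have hα₅ : 4 * α * S₅ ≤ δ := by
    have : α ≤ δ / (4 * S₅) := (min_le_right _ _).trans (min_le_right _ _)
    rw [le_div_iff₀ (by positivity)] at this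
    linarith
  refine ⟨ε, α, hε.le, min_le_left _ _, hα, fun z w H => ?_⟩
  obtain ⟨y₀, y₁, y₂, y₃, e⟩ := two_mul_energyForm_eq (S₁ := S₁) (S₂ := S₂) (S₃ := S₃)
    (S₄ := S₄) (S₅ := S₅) (ε := ε) hc₁.ne' hc₂.ne' H
  have hB := energyForm_le_mul (S₅ := S₅) (ε := ε) (min_le_left _ _) (div_pos h₁ hc₁).le
    (div_pos h₂ hc₁).le (div_pos h₃ hc₂).le (div_pos h₄ hc₂).le z
  set y₄ := z.v.fn 1
  set Y := y₀ ^ 2 + y₁ ^ 2 + y₂ ^ 2 + y₃ ^ 2 + y₄ ^ 2 with hY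
  have hy₄ : y₄ ^ 2 ≤ Y := by
    linarith [sq_nonneg y₀, sq_nonneg y₁, sq_nonneg y₂, sq_nonneg y₃]
  have hΨy := hδΨ ![y₀, y₁, y₂, y₃, y₄]
  rw [Matrix.neg_mulVec, dotProduct_neg] at hΨy
  have hsum : ∑ i, ![y₀, y₁, y₂, y₃, y₄] i ^ 2 = Y := by
    simp [Fin.sum_univ_succ, hY]
    ring
  rw [hsum] at hΨy
  have hE : S₁ * (y₂ + c₁ * y₁) ^ 2 + S₂ * (y₀ - c₁ * g * y₀) ^ 2
      + S₃ * (y₃ + c₂ * (-h * y₃ - q * y₄)) ^ 2 + S₄ * (y₂ - c₂ * y₁) ^ 2 ≤ K * Y := by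
    have key : ∀ a b x y : ℝ, x ^ 2 + y ^ 2 ≤ Y →
        (a * x + b * y) ^ 2 ≤ (a ^ 2 + b ^ 2) * Y := fun a b x y hxy =>
      (sq_add_le_mul a b x y).trans (mul_le_mul_of_nonneg_left hxy (by positivity))
    have k₁ := key 1 c₁ y₂ y₁ (by linarith [sq_nonneg y₀, sq_nonneg y₃, sq_nonneg y₄])
    have k₂ := key (1 - c₁ * g) 0 y₀ 0
      (by linarith [sq_nonneg y₁, sq_nonneg y₂, sq_nonneg y₃, sq_nonneg y₄])
    have k₃ := key (1 - c₂ * h) (-(c₂ * q)) y₃ y₄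
      (by linarith [sq_nonneg y₀, sq_nonneg y₁, sq_nonneg y₂])
    have k₄ := key 1 (-c₂) y₂ y₁ (by linarith [sq_nonneg y₀, sq_nonneg y₃, sq_nonneg y₄])
    have m₁ := mul_le_mul_of_nonneg_left k₁ h₁.le
    have m₂ := mul_le_mul_of_nonneg_left k₂ h₂.le
    have m₃ := mul_le_mul_of_nonneg_left k₃ h₃.le
    have m₄ := mul_le_mul_of_nonneg_left k₄ h₄.le
    refine le_of_eq_of_le ?_ ((add_le_add (add_le_add (add_le_add m₁ m₂) m₃) m₄).trans_eq ?_)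
    · ring
    · rw [hK]
      ring
  have hE' := mul_le_mul_of_nonneg_left hE hε.le
  have hεKY : ε * (K * Y) ≤ δ / 2 * Y := by
    rw [← mul_assoc]
    exact mul_le_mul_of_nonneg_right hεK (by positivity)
  have hδy : δ / 2 * y₄ ^ 2 ≤ δ / 2 * Y := mul_le_mul_of_nonneg_left hy₄ (by positivity)
  have hS₅ : 2 * α * (S₅ * y₄ ^ 2) ≤ δ / 2 * y₄ ^ 2 := by
    rw [← mul_assoc]
    exact mul_le_mul_of_nonneg_right (by linarith) (sq_nonneg _)
  have key : ∀ (S c : ℝ) (f : L2), 0 < S → 4 * α / c ≤ ε →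
      4 * α * (S / c * ‖f‖ ^ 2) ≤ ε * (S * ‖f‖ ^ 2) := fun S c f hS hc => by
    have := mul_le_mul_of_nonneg_right hc (show 0 ≤ S * ‖f‖ ^ 2 by positivity)
    refine le_of_eq_of_le ?_ this
    ring
  have n₁ := key S₁ c₁ (z.charU c₁) h₁ hα₁
  have n₂ := key S₂ c₁ (z.charU (-c₁)) h₂ hα₁
  have n₃ := key S₃ c₂ (z.charV c₂) h₃ hα₂
  have n₄ := key S₄ c₂ (z.charV (-c₂)) h₄ hα₂
  have hB' := mul_le_mul_of_nonneg_left hB (show 0 ≤ 2 * α by positivity)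
  linarith

/-! ### Inversion of the operator and conclusion -/

/-- The inverse of the operator of the closed loop. -/
theorem exists_inverse_closedLoop {c₁ c₂ g h q : ℝ} (hc₁ : c₁ ≠ 0) (hc₂ : c₂ ≠ 0) (hq : q ≠ 0)
    (hinj : ∀ z, ClosedLoopGraph c₁ c₂ g h q z 0 → z = 0) :
    ∃ R : StateSpace →ₗ[ℝ] StateSpace, ∀ z w, ClosedLoopGraph c₁ c₂ g h q z w ↔ R w = z := by
  choose R hR using exists_closedLoopGraph (g := g) (h := h) hc₁ hc₂ hq
  have huniq : ∀ z w, ClosedLoopGraph c₁ c₂ g h q z w → R w = z := fun z w H => by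
    have := (hR w).sub H
    rw [sub_self] at this
    exact sub_eq_zero.1 (hinj _ this)
  refine ⟨⟨⟨R, fun w w' => huniq _ _ ((hR w).add (hR w'))⟩,
    fun a w => huniq _ _ ((hR w).smul a)⟩, fun z w => ⟨huniq z w, ?_⟩⟩
  rintro rfl
  exact hR w

theorem isSolution_iff {c₁ c₂ g h q : ℝ} {R : StateSpace →ₗ[ℝ] StateSpace}
    (hR : ∀ z w, ClosedLoopGraph c₁ c₂ g h q z w ↔ R w = z) {z₀ : StateSpace}
    {z : ℝ → StateSpace} : IsSolution c₁ c₂ g h q z₀ z ↔ IsMild R z₀ z := by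
  refine ⟨fun H => ⟨H.continuousOn, fun t ht => (hR _ _).1 (H.equation t ht)⟩,
    fun H => ⟨H.continuousOn, ?_, fun t ht => (hR _ _).2 (H.equation t ht)⟩⟩
  -- The initial condition is encoded in the integrated equation: at `t = 0` it says that `A` maps
  -- `0` to `z 0 - z₀`, and `A` is single-valued.
  have h0 := H.equation 0 le_rfl
  rw [intervalIntegral.integral_same, ← hR] at h0
  exact sub_eq_zero.1 h0.eq_zero

end WaveLoop

open WaveLoop

theorem mainTheorem1 (c₁ c₂ g h q : ℝ) (hc₁ : 0 < c₁) (hc₂ : 0 < c₂) (hq : q ≠ 0)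
    (hLMI : ∃ S₁ S₂ S₃ S₄ S₅ : ℝ, 0 < S₁ ∧ 0 < S₂ ∧ 0 < S₃ ∧ 0 < S₄ ∧ 0 < S₅ ∧
      (-WaveLoop.Psi c₁ c₂ h q (c₁ * g) S₁ S₂ S₃ S₄ S₅ 0).PosDef) :
    ∃ γ α : ℝ, 1 < γ ∧ 0 < α ∧ ∀ z₀ : WaveLoop.StateSpace,
      ∃ z : ℝ → WaveLoop.StateSpace,
        WaveLoop.IsSolution c₁ c₂ g h q z₀ z ∧
        (∀ z' : ℝ → WaveLoop.StateSpace,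
          WaveLoop.IsSolution c₁ c₂ g h q z₀ z' → Set.EqOn z' z (Set.Ici 0)) ∧
        (∀ t : ℝ, 0 ≤ t →
          (z t).normH0 c₁ c₂ ≤ γ * z₀.normH0 c₁ c₂ * Real.exp (-α * t)) ∧
        Filter.Tendsto z Filter.atTop (nhds 0) := by
  obtain ⟨S₁, S₂, S₃, S₄, S₅, h₁, h₂, h₃, h₄, h₅, hΨ⟩ := hLMI
  obtain ⟨ε, α, hε, hε1, hα, hdiss⟩ := exists_energyForm_le hc₁ hc₂ h₁ h₂ h₃ h₄ h₅ hΨ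
  have d₁ := div_pos h₁ hc₁
  have d₂ := div_pos h₂ hc₁
  have d₃ := div_pos h₃ hc₂
  have d₄ := div_pos h₄ hc₂
  set B := energyForm c₁ c₂ S₁ S₂ S₃ S₄ S₅ ε
  obtain ⟨m, hm, hlow⟩ : ∃ m : ℝ, 0 < m ∧
      ∀ z : StateSpace, m * z.normH0 c₁ c₂ ^ 2 ≤ B z z := by
    refine ⟨min (min (S₁ / c₁) (S₂ / c₁)) (min (min (S₃ / c₂) (S₄ / c₂)) S₅),
      by simp only [lt_min_iff]; exact ⟨⟨d₁, d₂⟩, ⟨d₃, d₄⟩, h₅⟩,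
      mul_normH0_sq_le_energyForm ?_ hε ?_ ?_ ?_ ?_ ?_⟩
    · simp only [le_min_iff]
      exact ⟨⟨d₁.le, d₂.le⟩, ⟨d₃.le, d₄.le⟩, h₅.le⟩
    all_goals simp
  obtain ⟨M, hM, hupp⟩ : ∃ M : ℝ, 0 < M ∧
      ∀ z : StateSpace, B z z ≤ M * z.normH0 c₁ c₂ ^ 2 := by
    refine ⟨4 * (S₁ / c₁ + S₂ / c₁ + S₃ / c₂ + S₄ / c₂ + S₅), by positivity,
      energyForm_le_mul_normH0_sq hε1 d₁.le d₂.le d₃.le d₄.le ?_ ?_ ?_ ?_ ?_⟩ <;> linarith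
  set k := 1 + c₁⁻¹ + c₂⁻¹
  have hk : 0 < k := by positivity
  have hnorm : ∀ z : StateSpace, ‖z‖ ≤ k * z.normH0 c₁ c₂ := norm_le_normH0 hc₁ hc₂
  have hcoer : ∀ z : StateSpace, m / k ^ 2 * ‖z‖ ^ 2 ≤ B z z := fun z => by
    have e₁ := pow_le_pow_left₀ (norm_nonneg z) (hnorm z) 2
    have e₂ := mul_le_mul_of_nonneg_left e₁ (show 0 ≤ m / k ^ 2 by positivity)
    refine e₂.trans (le_of_eq_of_le ?_ (hlow z))
    field_simp
  have hbdd : ∀ z : StateSpace, B z z ≤ M * (c₁ ^ 2 + 1 + c₂ ^ 2 + 1 + 1) * ‖z‖ ^ 2 := fun z => by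
    rw [mul_assoc]
    exact (hupp z).trans (mul_le_mul_of_nonneg_left (normH0_sq_le c₁ c₂ z) hM.le)
  have hBpos : ∀ z : StateSpace, 0 ≤ B z z := fun z =>
    (show 0 ≤ m / k ^ 2 * ‖z‖ ^ 2 by positivity).trans (hcoer z)
  have hdef : ∀ z : StateSpace, B z z ≤ 0 → z = 0 := fun z hz => by
    have e₁ := (hcoer z).trans hz
    have e₂ : ‖z‖ ^ 2 ≤ 0 := nonpos_of_mul_nonpos_right e₁ (by positivity)
    exact norm_eq_zero.1 (pow_eq_zero_iff two_ne_zero |>.1 (le_antisymm e₂ (sq_nonneg _)))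
  let core : InnerProductSpace.Core ℝ StateSpace :=
    { inner := B
      conj_inner_symm := fun x y => energyForm_comm y x
      re_inner_nonneg := hBpos
      add_left := energyForm_add_left
      smul_left := fun x y r => energyForm_smul_left r x y
      definite := fun x hx => hdef x hx.le }
  have hB0 : ∀ z : StateSpace, B z 0 = 0 := fun z => by
    have := energyForm_smul_left (c₁ := c₁) (c₂ := c₂) (S₁ := S₁) (S₂ := S₂) (S₃ := S₃)
      (S₄ := S₄) (S₅ := S₅) (ε := ε) 0 0 z
    rw [zero_smul, zero_mul, energyForm_comm] at this
    exact this
  -- If `A z = 0`, dissipativity reads `0 ≤ -α B z z`, so `z = 0`.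
  obtain ⟨R, hR⟩ := exists_inverse_closedLoop hc₁.ne' hc₂.ne' hq fun z hz => hdef z (by
    have := hdiss z 0 hz
    rw [hB0] at this
    nlinarith)
  obtain ⟨hex, hdecay⟩ := exists_isMild_and_decay core (a := m / k ^ 2) (by positivity) hα hcoer
    hbdd R (fun w => hdiss _ _ ((hR _ _).2 rfl)) fun w hw => ((hR 0 w).2 hw).eq_zero
  have hdecay' : ∀ z₀ z, IsMild R z₀ z → ∀ t, 0 ≤ t →
      (z t).normH0 c₁ c₂ ≤ (1 + M / m) * z₀.normH0 c₁ c₂ * Real.exp (-α * t) := by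
    intro z₀ z hz t ht
    have n₀ := normH0_nonneg c₁ c₂ z₀
    refine (pow_le_pow_iff_left₀ (normH0_nonneg _ _ _) (by positivity) two_ne_zero).1 ?_
    have e₁ := (hlow (z t)).trans ((hdecay z₀ z hz t ht).trans
      (mul_le_mul_of_nonneg_left (hupp z₀) (sq_nonneg _)))
    -- Comparing norms costs a factor `√(M/m)`; replacing it by `1 + M/m` avoids the root and makes
    -- the constant exceed `1`.
    have e₂ : M / m ≤ (1 + M / m) ^ 2 := by
      have : 0 < M / m := by positivity
      nlinarith
    calc (z t).normH0 c₁ c₂ ^ 2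
        ≤ Real.exp (-α * t) ^ 2 * (M * z₀.normH0 c₁ c₂ ^ 2) / m := (le_div_iff₀' hm).2 e₁
      _ = M / m * (z₀.normH0 c₁ c₂ ^ 2 * Real.exp (-α * t) ^ 2) := by ring
      _ ≤ (1 + M / m) ^ 2 * (z₀.normH0 c₁ c₂ ^ 2 * Real.exp (-α * t) ^ 2) :=
        mul_le_mul_of_nonneg_right e₂ (by positivity)
      _ = _ := by ring
  refine ⟨1 + M / m, α, lt_add_of_pos_right 1 (by positivity), hα, fun z₀ => ?_⟩
  obtain ⟨z, hz⟩ := hex z₀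
  refine ⟨z, (isSolution_iff hR).2 hz, fun z' hz' t ht => ?_, hdecay' z₀ z hz, ?_⟩
  -- The difference of two solutions is a mild solution started at zero, and decay keeps its energy
  -- at zero.
  · have e₁ := hdecay _ _ (((isSolution_iff hR).1 hz').sub (map_sub R) hz) t ht
    rw [sub_self, show core.inner 0 0 = 0 from hB0 0, mul_zero] at e₁
    exact sub_eq_zero.1 (hdef _ e₁)
  · refine squeeze_zero_norm' (a := fun t =>
      k * ((1 + M / m) * z₀.normH0 c₁ c₂ * Real.exp (-α * t))) ?_ ?_
    · filter_upwards [eventually_ge_atTop 0] with t ht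
      exact (hnorm _).trans (mul_le_mul_of_nonneg_left (hdecay' z₀ z hz t ht) hk.le)
    · have e₁ : Tendsto (fun t : ℝ => Real.exp (-α * t)) atTop (𝓝 0) :=
        Real.tendsto_exp_atBot.comp (tendsto_id.const_mul_atTop_of_neg (neg_neg_of_pos hα))
      simpa using (e₁.const_mul ((1 + M / m) * z₀.normH0 c₁ c₂)).const_mul k
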